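/- Let $d\ge 1$, let $\mathbb{P}^{N_d}$ be the projective space of nonzero forms $\sum_{|\alpha|=d}a_\alpha Z^\alpha$ of degree $d$ in $Z_0,\dots,Z_4$ over $\mathbb{C}$ up to scalars, and let $\mathcal{X}=\{\sum_{|\alpha|=d}a_\alpha Z^\alpha=0\}\subset\mathbb{P}^4\times\mathbb{P}^{N_d}$ be the universal hypersurface, with projection $\pi:\mathcal{X}\to\mathbb{P}^{N_d}$. Let $J_3^v(\mathcal{X})$ be the space of $3$-jets of curves in $\mathcal{X}$ tangent to the fibres of $\pi$, that is, of pairs consisting of a point $[a]\in\mathbb{P}^{N_d}$ and a $3$-jet of a curve $[Z(t)]$ in $\mathbb{P}^4$ such that $\sum a_\alpha Z(t)^\alpha\equiv 0 \bmod t^4$. In each affine chart $\{Z_i\ne0,\ a_\beta\ne 0\}$ it is the subvariety of the affine space with coordinates $(z,a,\xi^{(1)},\xi^{(2)},\xi^{(3)})$ (where $\xi^{(k)}=z^{(k)}(0)$) given by the four equations $\frac{d^k}{dt^k}\big|_{t=0}\sum a_\alpha z(t)^\alpha=0$, $k=0,1,2,3$; a tangent vector to it is a vector annihilated by the differentials of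 these equations, and $T_{J_3^v(\mathcal{X})}$ is the corresponding tangent sheaf, whose sections are the regular vector fields tangent to $J_3^v(\mathcal{X})$. Let $\Sigma_0$ be the set of points $(z,a,\xi^{(1)},\xi^{(2)},\xi^{(3)})$ of $J_3^v(\mathcal{X})$ in the chart $\{Z_0\neq 0,\ a_{0d000}\ne0\}$ with $\xi^{(1)}\wedge\xi^{(2)}\wedge\xi^{(3)}=0$, and let $\Sigma$ be the closure of $\Sigma_0$ in $J_3^v(\mathcal{X})$. Then there is an integer $m$ (depending on $d$) such that $T_{J_3^v(\mathcal{X})}\otimes\mathcal{O}_{\mathbb{P}^4}(12)\otimes\mathcal{O}_{\mathbb{P}^{N_d}}(m)$ (line bundles pulled back to $J_3^v(\mathcal{X})$) is generated by its global algebraic sections at every point of $J_3^v(\mathcal{X})\setminus\Sigma$: for every $x\in J_3^v(\mathcal{X})\setminus\Sigma$, evaluation at $x$ maps the global sections over $J_3^v(\mathcal{X})$ onto the fibre $T_xJ_3^v(\mathcal{X})\otimes\mathcal{O}_{\mathbb{P}^4}(12)\otimes\mathcal{O}_{\mathbb{P}^{N_d}}(m)$. -/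

import Mathlib

open scoped Nat PowerSeries

noncomputable section

namespace VerticalJets

/-- Multi-indices `α ∈ ℕ⁵` with `|α| = d`; they index the coefficients `a_α` of a form of degree `d`
in the five homogeneous coordinates of `ℙ⁴`, hence the homogeneous coordinates of `ℙ^{N_d}`. -/
abbrev MultiIndex (d : ℕ) : Type := ↥(Finset.piAntidiag (Finset.univ : Finset (Fin 5)) d)

/-- The multi-index `(0, d, 0, 0, 0)`. -/
def pureIndex (d : ℕ) : MultiIndex d :=
  ⟨Pi.single 1 d, by simp⟩

/-- Homogeneous data `(Z, a)`. Here `Z k j` is the `k`-th derivative at `t = 0` of the `j`-th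
coordinate of a curve `t ↦ Z(t) ∈ ℂ⁵`, for `0 ≤ k ≤ 3`, and `a` is a family of coefficients. -/
abbrev HomogData (d : ℕ) : Type := (Fin 4 → Fin 5 → ℂ) × (MultiIndex d → ℂ)

/-- The Taylor polynomial `∑_{k ≤ 3} Z k j tᵏ / k!` of the `j`-th coordinate, as a power series. -/
def jetSeries (Z : Fin 4 → Fin 5 → ℂ) (j : Fin 5) : ℂ⟦X⟧ :=
  ∑ k : Fin 4, PowerSeries.monomial (k : ℕ) (Z k j / ((k : ℕ)! : ℂ))

/-- The series `t ↦ ∑_{|α| = d} a_α Z(t)^α`. -/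
def pulledBackForm {d : ℕ} (p : HomogData d) : ℂ⟦X⟧ :=
  ∑ α : MultiIndex d, PowerSeries.C (p.2 α) * ∏ j : Fin 5, jetSeries p.1 j ^ (α.1 j)

/-- The `k`-th equation of the vertical jet space: the `k`-th derivative at `t = 0` of
`∑ a_α Z(t)^α`, with `a` constant. -/
def jetEquation {d : ℕ} (k : Fin 4) (p : HomogData d) : ℂ :=
  ((k : ℕ)! : ℂ) * PowerSeries.coeff (k : ℕ) (pulledBackForm p)

/-- Homogeneous representatives of vertical `3`-jets of the universal hypersurface
`𝒳 = {∑ a_α Z^α = 0} ⊂ ℙ⁴ × ℙ^{N_d}`: the lift `Z(t)` to `ℂ⁵ ∖ 0` of a curve in `ℙ⁴` and a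
nonzero `a`, such that `Z(t)` satisfies the equation of the hypersurface `𝒳_a` up to order `3`. -/
def jetCone (d : ℕ) : Set (HomogData d) :=
  {p | p.1 0 ≠ 0 ∧ p.2 ≠ 0 ∧ ∀ k : Fin 4, jetEquation k p = 0}

/-- Two representatives give the same vertical `3`-jet if the lifts differ, modulo `t⁴`, by
a nowhere vanishing factor `lam(t)`, and the coefficients by a nonzero constant `mu`. -/
def sameJet {d : ℕ} (p q : jetCone d) : Prop :=
  (∃ lam : ℂ⟦X⟧ˣ, ∀ j : Fin 5,
      (PowerSeries.X : ℂ⟦X⟧) ^ 4 ∣ jetSeries q.1.1 j - (lam : ℂ⟦X⟧) * jetSeries p.1.1 j) ∧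
    ∃ mu : ℂˣ, q.1.2 = (mu : ℂ) • p.1.2

instance jetSetoid (d : ℕ) : Setoid (jetCone d) where
  r := sameJet
  iseqv :=
    { refl := fun _ => ⟨⟨1, fun j => by simp⟩, ⟨1, by simp⟩⟩
      symm := by
        rintro p q ⟨⟨lam, h⟩, ⟨mu, hmu⟩⟩
        refine ⟨⟨lam⁻¹, fun j => ?_⟩, ⟨mu⁻¹, by rw [hmu, smul_smul]; simp⟩⟩
        have e : jetSeries p.1.1 j - ((lam⁻¹ : ℂ⟦X⟧ˣ) : ℂ⟦X⟧) * jetSeries q.1.1 j =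
            -((lam⁻¹ : ℂ⟦X⟧ˣ) : ℂ⟦X⟧) * (jetSeries q.1.1 j - (lam : ℂ⟦X⟧) * jetSeries p.1.1 j) := by
          have := lam.inv_mul
          linear_combination (-jetSeries p.1.1 j) * this
        rw [e]
        exact (h j).mul_left _
      trans := by
        rintro p q r ⟨⟨lam, h⟩, ⟨mu, hmu⟩⟩ ⟨⟨lam', h'⟩, ⟨mu', hmu'⟩⟩
        refine ⟨⟨lam' * lam, fun j => ?_⟩, ⟨mu' * mu, by rw [hmu', hmu, smul_smul]; simp⟩⟩
        have e : jetSeries r.1.1 j - ((lam' * lam : ℂ⟦X⟧ˣ) : ℂ⟦X⟧) * jetSeries p.1.1 j =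
            (jetSeries r.1.1 j - (lam' : ℂ⟦X⟧) * jetSeries q.1.1 j) +
              (lam' : ℂ⟦X⟧) * (jetSeries q.1.1 j - (lam : ℂ⟦X⟧) * jetSeries p.1.1 j) := by
          push_cast
          ring
        rw [e]
        exact dvd_add (h' j) ((h j).mul_left _) }

/-- The space `J₃ᵛ(𝒳)` of vertical `3`-jets of the universal hypersurface of degree `d` in `ℙ⁴`,
with the quotient topology. -/
abbrev VerticalJet (d : ℕ) : Type := Quotient (jetSetoid d)

/-- The affine chart `{Z_i ≠ 0, a_β ≠ 0}` of `J₃ᵛ(𝒳)`. Its points are the normalized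
representatives, with `Z_i(t) = 1` identically and `a_β = 1`; the remaining entries are the affine
coordinates `z = Z 0`, `ξ⁽ᵏ⁾ = Z k` and `a`. -/
def chart (d : ℕ) (i : Fin 5) (β : MultiIndex d) : Set (HomogData d) :=
  {p | p ∈ jetCone d ∧ p.1 0 i = 1 ∧ (∀ k : Fin 4, k ≠ 0 → p.1 k i = 0) ∧ p.2 β = 1}

/-- The coordinate change to the chart `(i, β)`: the jet of `Z(t) / Z_i(t)` and `a / a_β`. -/
def toChart {d : ℕ} (i : Fin 5) (β : MultiIndex d) (p : HomogData d) : HomogData d :=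
  (fun k j => ((k : ℕ)! : ℂ) * PowerSeries.coeff (k : ℕ) (jetSeries p.1 j * (jetSeries p.1 i)⁻¹),
    (p.2 β)⁻¹ • p.2)

/-- The tangent space of `J₃ᵛ(𝒳)` at a point of the chart `(i, β)`, in the coordinates of the chart:
the vectors that are tangent to the affine space `{Z_i(t) = 1, a_β = 1}` and annihilated by the
differentials of the four equations. -/
def tangentSpaceAt {d : ℕ} (i : Fin 5) (β : MultiIndex d) (p : HomogData d) :
    Submodule ℂ (HomogData d) where
  carrier := {v | (∀ k : Fin 4, v.1 k i = 0) ∧ v.2 β = 0 ∧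
    ∀ k : Fin 4, fderiv ℂ (jetEquation (d := d) k) p v = 0}
  zero_mem' := by simp
  add_mem' := by
    rintro v w ⟨h1, h2, h3⟩ ⟨h1', h2', h3'⟩
    exact ⟨fun k => by simp [h1 k, h1' k], by simp [h2, h2'], fun k => by simp [h3 k, h3' k]⟩
  smul_mem' := by
    rintro c v ⟨h1, h2, h3⟩
    exact ⟨fun k => by simp [h1 k], by simp [h2], fun k => by simp [h3 k]⟩

/-- The list of all coordinates of `(Z, a)`. -/
def coords {d : ℕ} (p : HomogData d) : (Fin 4 × Fin 5) ⊕ MultiIndex d → ℂ :=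
  Sum.elim (fun x => p.1 x.1 x.2) p.2

/-- `f` is a regular function on the affine variety `S`: the restriction of a polynomial. -/
def IsRegularOn {d : ℕ} (S : Set (HomogData d)) (f : HomogData d → ℂ) : Prop :=
  ∃ P : MvPolynomial ((Fin 4 × Fin 5) ⊕ MultiIndex d) ℂ,
    ∀ p ∈ S, f p = MvPolynomial.eval (coords p) P

/-- A global (algebraic) section of `T_{J₃ᵛ(𝒳)} ⊗ 𝒪_{ℙ⁴}(e) ⊗ 𝒪_{ℙ^{N_d}}(m)`, given by its
expressions in the trivializations over the affine charts: on each chart a regular vector field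
tangent to `J₃ᵛ(𝒳)`, any two of which are related on the overlap by the differential of the
coordinate change and the transition function `(Z_i / Z_j)^e (a_β / a_γ)^m`
of the line bundle (on the chart `(i, β)` one has `Z_i = 1` and `a_β = 1`).
Only the values of `field i β` on `chart d i β` matter. -/
structure TwistedVectorField (d : ℕ) (e m : ℤ) where
  /-- the expression of the section in the chart `(i, β)` -/
  field : Fin 5 → MultiIndex d → HomogData d → HomogData d
  regular_jet : ∀ i β k j, IsRegularOn (chart d i β) (fun p => (field i β p).1 k j)
  regular_coeff : ∀ i β α, IsRegularOn (chart d i β) (fun p => (field i β p).2 α)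
  tangent : ∀ i β, ∀ p ∈ chart d i β, field i β p ∈ tangentSpaceAt i β p
  glue : ∀ i β j γ, ∀ p ∈ chart d i β, p.1 0 j ≠ 0 → p.2 γ ≠ 0 →
    field j γ (toChart j γ p) =
      (((p.1 0 j)⁻¹) ^ e * ((p.2 γ)⁻¹) ^ m) •
        fderiv ℂ (toChart (d := d) j γ) p (field i β p)

/-- The locus `ξ⁽¹⁾ ∧ ξ⁽²⁾ ∧ ξ⁽³⁾ = 0` in the affine chart `{Z₀ ≠ 0, a_{0d000} ≠ 0}`. -/
def sigmaZero (d : ℕ) : Set (VerticalJet d) :=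
  {x | ∃ p : jetCone d, p.1 ∈ chart d 0 (pureIndex d) ∧ x = Quotient.mk (jetSetoid d) p ∧
    exteriorPower.ιMulti ℂ 3 ![p.1.1 1, p.1.1 2, p.1.1 3] = 0}

/-- `Σ`, the closure of the above locus in `J₃ᵛ(𝒳)`. -/
def sigma (d : ℕ) : Set (VerticalJet d) := closure (sigmaZero d)

/-- `T_{J₃ᵛ(𝒳)} ⊗ 𝒪_{ℙ⁴}(e) ⊗ 𝒪_{ℙ^{N_d}}(m)` is generated by its global sections at `x`: evaluation
of global sections is onto the fibre, which every chart around `x` identifies with the tangent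
space at `x`. -/
def IsGloballyGeneratedAt (d : ℕ) (e m : ℤ) (x : VerticalJet d) : Prop :=
  ∀ i β, ∀ p : jetCone d, p.1 ∈ chart d i β → Quotient.mk (jetSetoid d) p = x →
    ∀ v ∈ tangentSpaceAt i β p.1, ∃ s : TwistedVectorField d e m, s.field i β p.1 = v

end VerticalJets

end

/-! A jet is given by homogeneous data `(Z, a)`, taken up to rescaling `Z(t)` by a unit series
`lam(t)` and `a` by a constant `mu`. A polynomial vector field on these data that is tangent to the
cone and equivariant with extra weight `lam(0) ^ 12` descends to a section of the tangent sheaf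
twisted by `𝒪(12)` (`IsHomogField.toTwisted`). No twist in `a` occurs, so `m = 0` works. It remains
to produce enough such fields.

Call a jet nondegenerate if `Z, Z', Z'', Z'''` are linearly independent in `ℂ⁵`. At such a jet every
tangent vector is a value of an equivariant field (`mem_fieldValues`). The infinitesimal action of
`GL₅`, multiplied by `Z_i ^ 12`, realizes any prescribed motion of the jet. What is left moves only
the coefficients, along a form vanishing to order `3` on the curve. For `d ≥ 2` these forms are
generated by the quadrics among them (`vanishingForms_le_mul`). Cramer's rule extends each such
quadric to a family of quadrics depending polynomially on the jet and vanishing along it. The `4 ×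
4` determinant of values of quadrics has weight `8`, which a power of `Z_i` raises to `12`. For `d =
1` linear forms replace the quadrics.

Degenerate jets lie in `Σ` (`mem_sigma_of_not_linearIndependent`): in the distinguished chart
degeneracy forces the wedge condition, and any other degenerate jet is a limit of degenerate jets in
that chart, reached along a path of linear changes of coordinates. -/

noncomputable section

namespace VerticalJets

open PowerSeries

/-! ### Series modulo `t⁴` -/

/-- Reduction of power series modulo `t⁴`. -/
abbrev modX4 : ℂ⟦X⟧ →ₐ[ℂ] ℂ⟦X⟧ ⧸ Ideal.span {(X : ℂ⟦X⟧) ^ 4} := Ideal.Quotient.mkₐ ℂ _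

theorem modX4_eq_iff_dvd {f g : ℂ⟦X⟧} : modX4 f = modX4 g ↔ (X : ℂ⟦X⟧) ^ 4 ∣ f - g := by
  rw [Ideal.Quotient.mkₐ_eq_mk, Ideal.Quotient.eq, Ideal.mem_span_singleton]

theorem modX4_eq_iff_coeff {f g : ℂ⟦X⟧} :
    modX4 f = modX4 g ↔ ∀ k : Fin 4, coeff (k : ℕ) f = coeff (k : ℕ) g := by
  rw [modX4_eq_iff_dvd, X_pow_dvd_iff]
  simp only [map_sub, sub_eq_zero]
  exact ⟨fun h k => h k k.2, fun h m hm => h ⟨m, hm⟩⟩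

theorem modX4_eq_zero_iff_coeff {f : ℂ⟦X⟧} :
    modX4 f = 0 ↔ ∀ k : Fin 4, coeff (k : ℕ) f = 0 := by
  rw [← map_zero modX4, modX4_eq_iff_coeff]
  simp

theorem coeff_jetSeries (Z : Fin 4 → Fin 5 → ℂ) (j : Fin 5) (k : Fin 4) :
    coeff (k : ℕ) (jetSeries Z j) = Z k j / ((k : ℕ)! : ℂ) := by
  rw [jetSeries, map_sum, Finset.sum_eq_single k]
  · simp
  · intro l _ hl
    rw [coeff_monomial, if_neg]
    exact fun h => hl (Fin.ext h.symm)
  · simp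

theorem factorial_cast_ne_zero (k : ℕ) : (k ! : ℂ) ≠ 0 := by
  exact_mod_cast k.factorial_ne_zero

theorem constantCoeff_jetSeries (Z : Fin 4 → Fin 5 → ℂ) (j : Fin 5) :
    constantCoeff (jetSeries Z j) = Z 0 j := by
  have := coeff_jetSeries Z j 0
  simpa using this

/-- The derivatives up to order `3` at `t = 0` of a family of five series. -/
def jetOf (f : Fin 5 → ℂ⟦X⟧) : Fin 4 → Fin 5 → ℂ :=
  fun k j => ((k : ℕ)! : ℂ) * coeff (k : ℕ) (f j)

theorem modX4_jetSeries_jetOf (f : Fin 5 → ℂ⟦X⟧) (j : Fin 5) :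
    modX4 (jetSeries (jetOf f) j) = modX4 (f j) := by
  rw [modX4_eq_iff_coeff]
  intro k
  rw [coeff_jetSeries, jetOf, mul_div_cancel_left₀ _ (factorial_cast_ne_zero k)]

theorem jetOf_congr {f g : Fin 5 → ℂ⟦X⟧} (h : ∀ j, modX4 (f j) = modX4 (g j)) :
    jetOf f = jetOf g := by
  funext k j
  rw [jetOf, jetOf, modX4_eq_iff_coeff.1 (h j) k]

theorem jetOf_jetSeries (Z : Fin 4 → Fin 5 → ℂ) : jetOf (jetSeries Z) = Z := by
  funext k j
  rw [jetOf, coeff_jetSeries, mul_div_cancel₀ _ (factorial_cast_ne_zero k)]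

theorem jetSeries_injective_modX4 {Z W : Fin 4 → Fin 5 → ℂ}
    (h : ∀ j, modX4 (jetSeries Z j) = modX4 (jetSeries W j)) : Z = W := by
  rw [← jetOf_jetSeries Z, jetOf_congr h, jetOf_jetSeries]

theorem jetSeries_add (Z W : Fin 4 → Fin 5 → ℂ) (j : Fin 5) :
    jetSeries (Z + W) j = jetSeries Z j + jetSeries W j := by
  simp only [jetSeries, Pi.add_apply, add_div, map_add, Finset.sum_add_distrib]

theorem jetSeries_smul (c : ℂ) (Z : Fin 4 → Fin 5 → ℂ) (j : Fin 5) :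
    jetSeries (c • Z) j = c • jetSeries Z j := by
  simp only [jetSeries, Pi.smul_apply, smul_eq_mul, mul_div_assoc, Finset.smul_sum,
    ← map_smul]

/-! ### Forms and their coefficients -/

/-- The exponent of the monomial attached to a multi-index. -/
abbrev expOf {d : ℕ} (α : MultiIndex d) : Fin 5 →₀ ℕ := Finsupp.equivFunOnFinite.symm α.1

theorem degree_expOf {d : ℕ} (α : MultiIndex d) : (expOf α).degree = d := by
  have := (Finset.mem_piAntidiag.1 α.2).1
  rw [Finsupp.degree_eq_sum]
  simpa using this

/-- The form `∑ a_α Z^α` with coefficients `a`. -/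
def formOf (d : ℕ) : (MultiIndex d → ℂ) →ₗ[ℂ] MvPolynomial (Fin 5) ℂ :=
  ∑ α : MultiIndex d, (MvPolynomial.monomial (expOf α)).comp (LinearMap.proj α)

/-- The coefficients of degree `d` of a polynomial. -/
def coeffsOf (d : ℕ) : MvPolynomial (Fin 5) ℂ →ₗ[ℂ] (MultiIndex d → ℂ) :=
  LinearMap.pi fun α => MvPolynomial.lcoeff ℂ (expOf α)

theorem formOf_apply {d : ℕ} (a : MultiIndex d → ℂ) :
    formOf d a = ∑ α : MultiIndex d, MvPolynomial.monomial (expOf α) (a α) := by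
  simp [formOf]

theorem coeffsOf_apply {d : ℕ} (f : MvPolynomial (Fin 5) ℂ) (α : MultiIndex d) :
    coeffsOf d f α = f.coeff (expOf α) := rfl

theorem isHomogeneous_formOf {d : ℕ} (a : MultiIndex d → ℂ) : (formOf d a).IsHomogeneous d := by
  rw [formOf_apply]
  exact MvPolynomial.IsHomogeneous.sum _ _ _ fun α _ =>
    MvPolynomial.isHomogeneous_monomial _ (degree_expOf α)

theorem expOf_injective {d : ℕ} : Function.Injective (expOf (d := d)) := fun _ _ h =>
  Subtype.ext (Finsupp.equivFunOnFinite.symm.injective h)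

theorem coeffsOf_formOf {d : ℕ} (a : MultiIndex d → ℂ) : coeffsOf d (formOf d a) = a := by
  funext α
  rw [coeffsOf_apply, formOf_apply, MvPolynomial.coeff_sum, Finset.sum_eq_single α]
  · simp
  · intro β _ hβ
    rw [MvPolynomial.coeff_monomial, if_neg]
    exact fun h => hβ (expOf_injective h)
  · simp

theorem formOf_coeffsOf {d : ℕ} {f : MvPolynomial (Fin 5) ℂ} (hf : f.IsHomogeneous d) :
    formOf d (coeffsOf d f) = f := by
  ext m
  by_cases hm : m.degree = d
  · have hmem : (⇑m : Fin 5 → ℕ) ∈ Finset.piAntidiag (Finset.univ : Finset (Fin 5)) d := by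
      rw [Finset.mem_piAntidiag]
      refine ⟨?_, by simp⟩
      rw [← hm, Finsupp.degree_eq_sum]
    have h1 : m = expOf (⟨m, hmem⟩ : MultiIndex d) := by ext; rfl
    have h2 := congrFun (coeffsOf_formOf (coeffsOf d f)) ⟨m, hmem⟩
    rw [coeffsOf_apply, coeffsOf_apply, ← h1] at h2
    exact h2
  · rw [(isHomogeneous_formOf _).coeff_eq_zero hm, hf.coeff_eq_zero hm]

/-- Restriction of polynomials to the curve `t ↦ Z(t)`. -/
abbrev evalJet (Z : Fin 4 → Fin 5 → ℂ) : MvPolynomial (Fin 5) ℂ →ₐ[ℂ] ℂ⟦X⟧ :=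
  MvPolynomial.aeval (jetSeries Z)

theorem pulledBackForm_eq {d : ℕ} (p : HomogData d) :
    pulledBackForm p = evalJet p.1 (formOf d p.2) := by
  rw [pulledBackForm, formOf_apply, map_sum]
  refine Finset.sum_congr rfl fun α _ => ?_
  rw [MvPolynomial.aeval_monomial, Finsupp.prod_fintype _ _ (by simp)]
  rfl

/-- Replaces the four scalar equations by one equation in the ring `ℂ⟦t⟧ / t⁴`, where products and
homogeneity can be used directly. -/
theorem jetEquations_iff {d : ℕ} (p : HomogData d) :
    (∀ k : Fin 4, jetEquation k p = 0) ↔ modX4 (evalJet p.1 (formOf d p.2)) = 0 := by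
  rw [modX4_eq_zero_iff_coeff, ← pulledBackForm_eq]
  simp [jetEquation, Nat.factorial_ne_zero]

theorem modX4_evalJet (Z : Fin 4 → Fin 5 → ℂ) (f : MvPolynomial (Fin 5) ℂ) :
    modX4 (evalJet Z f) = MvPolynomial.aeval (fun j => modX4 (jetSeries Z j)) f := by
  rw [← AlgHom.comp_apply, MvPolynomial.comp_aeval]

/-- A homogeneous form of degree `d` scales by `lam ^ d`. -/
theorem aeval_mul_of_isHomogeneous {A : Type*} [CommRing A] [Algebra ℂ A] {d : ℕ}
    {f : MvPolynomial (Fin 5) ℂ} (hf : f.IsHomogeneous d) (u : A) (z : Fin 5 → A) :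
    MvPolynomial.aeval (fun j => u * z j) f = u ^ d * MvPolynomial.aeval z f := by
  simp only [MvPolynomial.aeval_def, MvPolynomial.eval₂_eq, Finset.mul_sum]
  refine Finset.sum_congr rfl fun m hm => ?_
  have h : m.degree = d := by
    by_contra h
    exact (MvPolynomial.mem_support_iff.1 hm) (hf.coeff_eq_zero h)
  rw [Finsupp.degree_apply] at h
  simp only [mul_pow, Finset.prod_mul_distrib, Finset.prod_pow_eq_pow_sum, h]
  ring

/-- Euler's identity, evaluated at a point of an algebra. -/
theorem sum_aeval_pderiv_mul {A : Type*} [CommRing A] [Algebra ℂ A] {d : ℕ}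
    {f : MvPolynomial (Fin 5) ℂ} (hf : f.IsHomogeneous d) (z : Fin 5 → A) :
    ∑ j, MvPolynomial.aeval z (MvPolynomial.pderiv j f) * z j =
      (d : A) * MvPolynomial.aeval z f := by
  have h := congrArg (MvPolynomial.aeval z) hf.sum_X_mul_pderiv
  simpa [mul_comm] using h

end VerticalJets

end

/-! ### Differentials of the jet equations and of the chart changes. -/

noncomputable section

namespace VerticalJets

open PowerSeries

/-! ### Differentiation of families of power series -/

section SeriesDerivative

variable {E : Type*} [NormedAddCommGroup E] [NormedSpace ℂ E]

/-- The family of power series `f` is coefficientwise differentiable at `x`, and its derivative in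
the direction `v` is `f' v`. -/
def HasSeriesFDerivAt (f f' : E → ℂ⟦X⟧) (x : E) : Prop :=
  ∀ n, ∃ L : E →L[ℂ] ℂ, HasFDerivAt (fun y => coeff n (f y)) L x ∧ ∀ v, L v = coeff n (f' v)

variable {f f' g g' : E → ℂ⟦X⟧} {x : E}

theorem HasSeriesFDerivAt.fderiv_coeff (hf : HasSeriesFDerivAt f f' x) (n : ℕ) (v : E) :
    fderiv ℂ (fun y => coeff n (f y)) x v = coeff n (f' v) := by
  obtain ⟨L, hL, hv⟩ := hf n
  rw [hL.fderiv, hv]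

theorem HasSeriesFDerivAt.differentiableAt_coeff (hf : HasSeriesFDerivAt f f' x) (n : ℕ) :
    DifferentiableAt ℂ (fun y => coeff n (f y)) x :=
  let ⟨_, hL, _⟩ := hf n
  hL.differentiableAt

theorem hasSeriesFDerivAt_of_differentiableAt
    (h : ∀ n, DifferentiableAt ℂ (fun y => coeff n (f y)) x) :
    HasSeriesFDerivAt f (fun v => mk fun n => fderiv ℂ (fun y => coeff n (f y)) x v) x :=
  fun n => ⟨_, (h n).hasFDerivAt, fun v => by simp⟩

theorem HasSeriesFDerivAt.unique {f'' : E → ℂ⟦X⟧} (h : HasSeriesFDerivAt f f' x)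
    (h' : HasSeriesFDerivAt f f'' x) : f' = f'' := by
  funext v
  ext n
  rw [← h.fderiv_coeff, h'.fderiv_coeff]

theorem HasSeriesFDerivAt.congr_deriv (h : HasSeriesFDerivAt f f' x) (e : ∀ v, f' v = g' v) :
    HasSeriesFDerivAt f g' x := by
  rwa [← funext e]

theorem HasSeriesFDerivAt.congr_of_eventuallyEq (h : HasSeriesFDerivAt f f' x)
    (e : ∀ᶠ y in nhds x, g y = f y) : HasSeriesFDerivAt g f' x := by
  intro n
  obtain ⟨L, hL, hv⟩ := h n
  exact ⟨L, hL.congr_of_eventuallyEq (e.mono fun y hy => by simp only [hy]), hv⟩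

theorem hasSeriesFDerivAt_const (c : ℂ⟦X⟧) (x : E) :
    HasSeriesFDerivAt (fun _ => c) (fun _ => 0) x :=
  fun _ => ⟨0, hasFDerivAt_const _ _, fun v => by simp⟩

theorem HasSeriesFDerivAt.add (hf : HasSeriesFDerivAt f f' x) (hg : HasSeriesFDerivAt g g' x) :
    HasSeriesFDerivAt (fun y => f y + g y) (fun v => f' v + g' v) x := by
  intro n
  obtain ⟨L, hL, hv⟩ := hf n
  obtain ⟨K, hK, hw⟩ := hg n
  refine ⟨L + K, ?_, fun v => by simp [hv, hw]⟩
  simpa only [map_add] using hL.fun_add hK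

theorem hasSeriesFDerivAt_sum {ι : Type*} (s : Finset ι) {f f' : ι → E → ℂ⟦X⟧}
    (h : ∀ i ∈ s, HasSeriesFDerivAt (f i) (f' i) x) :
    HasSeriesFDerivAt (fun y => ∑ i ∈ s, f i y) (fun v => ∑ i ∈ s, f' i v) x := by
  classical
  induction s using Finset.induction_on with
  | empty => simpa using hasSeriesFDerivAt_const (0 : ℂ⟦X⟧) x
  | insert i s hi ih =>
    simp only [Finset.sum_insert hi]
    exact (h i (by simp)).add (ih fun j hj => h j (by simp [hj]))

theorem HasSeriesFDerivAt.mul (hf : HasSeriesFDerivAt f f' x) (hg : HasSeriesFDerivAt g g' x) :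
    HasSeriesFDerivAt (fun y => f y * g y) (fun v => f' v * g x + f x * g' v) x := by
  intro n
  choose L hL hv using hf
  choose K hK hw using hg
  refine ⟨∑ q ∈ Finset.HasAntidiagonal.antidiagonal n,
    (coeff q.1 (f x) • K q.2 + coeff q.2 (g x) • L q.1), ?_, fun v => ?_⟩
  · simp only [coeff_mul]
    exact HasFDerivAt.fun_sum fun q _ => (hL q.1).fun_mul (hK q.2)
  · simp only [map_add, coeff_mul, sum_apply, add_apply, smul_apply, hv, hw, smul_eq_mul,
      ← Finset.sum_add_distrib]
    exact Finset.sum_congr rfl fun q _ => by ring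

/-- The recursion for the coefficients of an inverse gives differentiability without a formula; the
formula then follows by differentiating `f * f⁻¹ = 1`, valid near `x`, and using uniqueness of the
derivative. -/
theorem HasSeriesFDerivAt.inv (hf : HasSeriesFDerivAt f f' x) (hx : constantCoeff (f x) ≠ 0) :
    HasSeriesFDerivAt (fun y => (f y)⁻¹) (fun v => -(f' v * ((f x)⁻¹ * (f x)⁻¹))) x := by
  have h0 : DifferentiableAt ℂ (fun y => constantCoeff (f y)) x := by
    simpa using hf.differentiableAt_coeff 0
  have hd : ∀ n, DifferentiableAt ℂ (fun y => coeff n (f y)⁻¹) x := by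
    intro n
    induction n using Nat.strong_induction_on with
    | _ n ih =>
      rw [funext fun y => coeff_inv n (f y)]
      split_ifs with hn
      · exact h0.fun_inv hx
      · refine (h0.fun_inv hx).fun_neg.fun_mul (DifferentiableAt.fun_sum fun q _ => ?_)
        split_ifs with hq
        · exact (hf.differentiableAt_coeff _).fun_mul (ih _ hq)
        · exact differentiableAt_const _
  have hi := hasSeriesFDerivAt_of_differentiableAt hd
  have hev : ∀ᶠ y in nhds x, (1 : ℂ⟦X⟧) = f y * (f y)⁻¹ :=
    (h0.continuousAt.eventually_ne hx).mono fun y hy => (PowerSeries.mul_inv_cancel _ hy).symm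
  have hu := ((hf.mul hi).congr_of_eventuallyEq hev).unique (hasSeriesFDerivAt_const 1 x)
  refine hi.congr_deriv fun v => ?_
  have h1 := congrFun hu v
  have h2 := PowerSeries.mul_inv_cancel _ hx
  linear_combination (f x)⁻¹ * h1 -
    (mk fun n => (fderiv ℂ (fun y => coeff n (f y)⁻¹) x) v) * h2

theorem hasSeriesFDerivAt_aeval {f f' : Fin 5 → E → ℂ⟦X⟧}
    (h : ∀ j, HasSeriesFDerivAt (f j) (f' j) x) (F : MvPolynomial (Fin 5) ℂ) :
    HasSeriesFDerivAt (fun y => MvPolynomial.aeval (fun j => f j y) F)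
      (fun v => ∑ j, MvPolynomial.aeval (fun j => f j x) (MvPolynomial.pderiv j F) * f' j v) x := by
  induction F using MvPolynomial.induction_on with
  | C c => simpa using hasSeriesFDerivAt_const (algebraMap ℂ ℂ⟦X⟧ c) x
  | add F G hF hG =>
    simp only [map_add, add_mul, Finset.sum_add_distrib]
    exact hF.add hG
  | mul_X F i hF =>
    have := hF.mul (h i)
    simp only [map_mul, MvPolynomial.aeval_X]
    refine this.congr_deriv fun v => ?_
    simp only [Derivation.leibniz, MvPolynomial.pderiv_X, smul_eq_mul, map_add, map_mul,
      MvPolynomial.aeval_X, add_mul, Finset.sum_add_distrib]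
    refine (add_comm _ _).trans (congrArg₂ (· + ·) ?_ ?_)
    · rw [Finset.sum_eq_single i]
      · simp
      · intro j _ hj
        rw [Pi.single_eq_of_ne hj.symm]
        simp
      · simp
    · rw [Finset.sum_mul]
      exact Finset.sum_congr rfl fun j _ => by ring

end SeriesDerivative

/-! ### Differentials of the equations and of the coordinate changes -/

variable {d : ℕ}

theorem hasSeriesFDerivAt_jetSeries (p : HomogData d) (j : Fin 5) :
    HasSeriesFDerivAt (fun q : HomogData d => jetSeries q.1 j) (fun v => jetSeries v.1 j) p := by
  intro n
  have hlin : IsLinearMap ℂ (fun q : HomogData d => coeff n (jetSeries q.1 j)) :=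
    ⟨fun v w => by simp [jetSeries_add], fun c v => by simp [jetSeries_smul]⟩
  exact ⟨hlin.mk'.toContinuousLinearMap, hlin.mk'.toContinuousLinearMap.hasFDerivAt, fun v => rfl⟩

theorem hasSeriesFDerivAt_C_coeff (p : HomogData d) (α : MultiIndex d) :
    HasSeriesFDerivAt (fun q : HomogData d => C (q.2 α)) (fun v => C (v.2 α)) p := by
  intro n
  have hlin : IsLinearMap ℂ (fun q : HomogData d => coeff n (C (q.2 α))) :=
    ⟨fun v w => by simp, fun c v => by simp [coeff_C]⟩
  exact ⟨hlin.mk'.toContinuousLinearMap, hlin.mk'.toContinuousLinearMap.hasFDerivAt, fun v => rfl⟩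

/-- The derivative of the series `∑ a_α Z(t)^α` at `p` in the direction `v`. -/
def formDifferential (p v : HomogData d) : ℂ⟦X⟧ :=
  ∑ j, evalJet p.1 (MvPolynomial.pderiv j (formOf d p.2)) * jetSeries v.1 j +
    evalJet p.1 (formOf d v.2)

theorem evalJet_formOf (Z : Fin 4 → Fin 5 → ℂ) (a : MultiIndex d → ℂ) :
    evalJet Z (formOf d a) =
      ∑ α, C (a α) * evalJet Z (MvPolynomial.monomial (expOf α) 1) := by
  rw [formOf_apply, map_sum]
  refine Finset.sum_congr rfl fun α _ => ?_
  simp [MvPolynomial.aeval_monomial]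

theorem hasSeriesFDerivAt_pulledBackForm (p : HomogData d) :
    HasSeriesFDerivAt (fun q => pulledBackForm q) (formDifferential p) p := by
  simp only [pulledBackForm_eq, evalJet_formOf]
  refine (hasSeriesFDerivAt_sum Finset.univ fun α _ => (hasSeriesFDerivAt_C_coeff p α).mul
    (hasSeriesFDerivAt_aeval (hasSeriesFDerivAt_jetSeries p)
      (MvPolynomial.monomial (expOf α) 1))).congr_deriv fun v => ?_
  rw [formDifferential, evalJet_formOf, Finset.sum_add_distrib, add_comm]
  congr 1
  simp only [Finset.mul_sum]
  rw [Finset.sum_comm]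
  refine Finset.sum_congr rfl fun j _ => ?_
  rw [formOf_apply, map_sum, map_sum, Finset.sum_mul]
  refine Finset.sum_congr rfl fun α _ => ?_
  have : MvPolynomial.monomial (expOf α) (p.2 α) =
      p.2 α • MvPolynomial.monomial (expOf α) (1 : ℂ) := by
    simp [MvPolynomial.smul_monomial]
  rw [this, Derivation.map_smul, map_smul, smul_eq_C_mul, mul_assoc]

theorem fderiv_jetEquation (k : Fin 4) (p v : HomogData d) :
    fderiv ℂ (jetEquation (d := d) k) p v =
      ((k : ℕ)! : ℂ) * coeff (k : ℕ) (formDifferential p v) := by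
  have h := hasSeriesFDerivAt_pulledBackForm p
  change fderiv ℂ (fun q => ((k : ℕ)! : ℂ) * coeff (k : ℕ) (pulledBackForm q)) p v = _
  rw [fderiv_const_mul (h.differentiableAt_coeff k)]
  simp [h.fderiv_coeff]

theorem mem_tangentSpaceAt_iff {i : Fin 5} {β : MultiIndex d} {p v : HomogData d} :
    v ∈ tangentSpaceAt i β p ↔ (∀ k, v.1 k i = 0) ∧ v.2 β = 0 ∧
      modX4 (formDifferential p v) = 0 := by
  change (_ ∧ _ ∧ ∀ k, _ = _) ↔ _
  simp only [fderiv_jetEquation, modX4_eq_zero_iff_coeff, mul_eq_zero, factorial_cast_ne_zero,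
    false_or]

/-- The differential at `p` of the coordinate change to the chart `(i, β)`. -/
def chartDifferential (i : Fin 5) (β : MultiIndex d) (p v : HomogData d) : HomogData d :=
  (jetOf fun j => jetSeries v.1 j * (jetSeries p.1 i)⁻¹ -
      jetSeries p.1 j * (jetSeries v.1 i * ((jetSeries p.1 i)⁻¹ * (jetSeries p.1 i)⁻¹)),
    (p.2 β)⁻¹ • v.2 - (v.2 β * ((p.2 β)⁻¹ * (p.2 β)⁻¹)) • p.2)

theorem fderiv_toChart {i : Fin 5} {β : MultiIndex d} {p : HomogData d} (hi : p.1 0 i ≠ 0)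
    (hβ : p.2 β ≠ 0) (v : HomogData d) :
    fderiv ℂ (toChart (d := d) i β) p v = chartDifferential i β p v := by
  have h1 : ∀ j, HasSeriesFDerivAt (fun q : HomogData d => jetSeries q.1 j * (jetSeries q.1 i)⁻¹)
      (fun v => jetSeries v.1 j * (jetSeries p.1 i)⁻¹ -
        jetSeries p.1 j * (jetSeries v.1 i * ((jetSeries p.1 i)⁻¹ * (jetSeries p.1 i)⁻¹))) p :=
    fun j => ((hasSeriesFDerivAt_jetSeries p j).mul ((hasSeriesFDerivAt_jetSeries p i).inv
      (by rwa [constantCoeff_jetSeries]))).congr_deriv fun v => by ring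
  have h2 : ∀ γ : MultiIndex d, HasFDerivAt (fun q : HomogData d => q.2 γ)
      ((ContinuousLinearMap.proj γ).comp (ContinuousLinearMap.snd ℂ _ _)) p := fun γ =>
    hasFDerivAt_pi'.1 hasFDerivAt_snd γ
  have h3 := (hasDerivAt_inv hβ).comp_hasFDerivAt p (h2 β)
  have hd1 : ∀ (k : Fin 4) j, DifferentiableAt ℂ (fun q => (toChart i β q).1 k j) p :=
    fun k j => ((h1 j).differentiableAt_coeff k).const_mul _
  have hd2 : ∀ γ, DifferentiableAt ℂ (fun q => (toChart i β q).2 γ) p :=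
    fun γ => (h3.mul (h2 γ)).differentiableAt
  have hd1' : DifferentiableAt ℂ (fun q => (toChart i β q).1) p :=
    differentiableAt_pi.2 fun k => differentiableAt_pi.2 fun j => hd1 k j
  have hd2' : DifferentiableAt ℂ (fun q => (toChart i β q).2) p := differentiableAt_pi.2 hd2
  have e : fderiv ℂ (toChart (d := d) i β) p =
      (fderiv ℂ (fun q => (toChart i β q).1) p).prod (fderiv ℂ (fun q => (toChart i β q).2) p) :=
    hd1'.fderiv_prodMk hd2'
  rw [e]
  refine Prod.ext ?_ ?_
  · funext k j
    have ek : fderiv ℂ (fun q => (toChart i β q).1) p v k j =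
        fderiv ℂ (fun q => (toChart i β q).1 k j) p v := by
      rw [fderiv_apply (differentiableAt_pi.1 hd1' k) j, fderiv_apply hd1' k]
      rfl
    change fderiv ℂ (fun q => (toChart i β q).1) p v k j = _
    rw [ek]
    change fderiv ℂ (fun q : HomogData d => ((k : ℕ)! : ℂ) *
      coeff (k : ℕ) (jetSeries q.1 j * (jetSeries q.1 i)⁻¹)) p v = _
    rw [fderiv_const_mul ((h1 j).differentiableAt_coeff k)]
    simp only [smul_apply, (h1 j).fderiv_coeff]
    rfl
  · funext γ
    change fderiv ℂ (fun q => (toChart i β q).2) p v γ = _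
    have ek : fderiv ℂ (fun q => (toChart i β q).2) p v γ =
        fderiv ℂ (fun q => (toChart i β q).2 γ) p v := by
      rw [fderiv_apply hd2' γ]
      rfl
    rw [ek]
    change fderiv ℂ ((Inv.inv ∘ fun q : HomogData d => q.2 β) * fun q : HomogData d => q.2 γ) p v
      = _
    rw [(h3.mul (h2 γ)).fderiv]
    simp [chartDifferential]
    ring

end VerticalJets

end

/-! ### Descent of equivariant fields on the cone to sections of the twisted tangent sheaf. -/

noncomputable section

namespace VerticalJets

open PowerSeries

variable {d : ℕ}

/-! ### Polynomial functions of the homogeneous data -/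

/-- The algebra of polynomial functions of `(Z, a)`. -/
def polyFunctions (d : ℕ) : Subalgebra ℂ (HomogData d → ℂ) :=
  (MvPolynomial.aeval (R := ℂ) fun x (p : HomogData d) => coords p x).range

theorem isRegularOn_of_mem_polyFunctions {f : HomogData d → ℂ} (hf : f ∈ polyFunctions d)
    (S : Set (HomogData d)) : IsRegularOn S f := by
  obtain ⟨P, rfl⟩ := hf
  refine ⟨P, fun p _ => ?_⟩
  have h := MvPolynomial.comp_aeval_apply (fun x (p : HomogData d) => coords p x)
    (Pi.evalAlgHom ℂ (fun _ : HomogData d => ℂ) p) P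
  simpa [MvPolynomial.aeval_eq_eval] using h

theorem coords_mem_polyFunctions (x : (Fin 4 × Fin 5) ⊕ MultiIndex d) :
    (fun p : HomogData d => coords p x) ∈ polyFunctions d :=
  ⟨MvPolynomial.X x, by simp⟩

theorem jet_mem_polyFunctions (k : Fin 4) (j : Fin 5) :
    (fun p : HomogData d => p.1 k j) ∈ polyFunctions d :=
  coords_mem_polyFunctions (Sum.inl (k, j))

theorem coefficient_mem_polyFunctions (α : MultiIndex d) :
    (fun p : HomogData d => p.2 α) ∈ polyFunctions d :=
  coords_mem_polyFunctions (Sum.inr α)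

theorem const_mem_polyFunctions (c : ℂ) : (fun _ : HomogData d => c) ∈ polyFunctions d :=
  (polyFunctions d).algebraMap_mem c

theorem sum_mem_polyFunctions {ι : Type*} (s : Finset ι) {f : ι → HomogData d → ℂ}
    (h : ∀ i ∈ s, f i ∈ polyFunctions d) : (fun p => ∑ i ∈ s, f i p) ∈ polyFunctions d := by
  have := sum_mem h
  rwa [Finset.sum_fn] at this

theorem prod_mem_polyFunctions {ι : Type*} (s : Finset ι) {f : ι → HomogData d → ℂ}
    (h : ∀ i ∈ s, f i ∈ polyFunctions d) : (fun p => ∏ i ∈ s, f i p) ∈ polyFunctions d := by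
  have := prod_mem h
  rwa [Finset.prod_fn] at this

theorem det_mem_polyFunctions {A : HomogData d → Matrix (Fin 4) (Fin 4) ℂ}
    (h : ∀ i j, (fun p => A p i j) ∈ polyFunctions d) :
    (fun p => (A p).det) ∈ polyFunctions d := by
  simp only [Matrix.det_apply']
  exact sum_mem_polyFunctions _ fun σ _ =>
    mul_mem (const_mem_polyFunctions _) (prod_mem_polyFunctions _ fun i _ => h _ _)

theorem adjugate_mem_polyFunctions {A : HomogData d → Matrix (Fin 4) (Fin 4) ℂ}
    (h : ∀ i j, (fun p => A p i j) ∈ polyFunctions d) (i j : Fin 4) :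
    (fun p => (A p).adjugate i j) ∈ polyFunctions d := by
  simp only [Matrix.adjugate_apply]
  -- An entry of the adjugate is the determinant of the matrix with one row replaced by a constant
  -- one.
  refine det_mem_polyFunctions fun k l => ?_
  by_cases hk : k = j
  · subst hk
    simpa using const_mem_polyFunctions _
  · simpa [Matrix.updateRow_ne hk] using h k l

/-- Families of power series with polynomial coefficients. -/
def HasPolyCoeffs (f : HomogData d → ℂ⟦X⟧) : Prop :=
  ∀ n, (fun p => coeff n (f p)) ∈ polyFunctions d

theorem HasPolyCoeffs.mul {f g : HomogData d → ℂ⟦X⟧} (hf : HasPolyCoeffs f)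
    (hg : HasPolyCoeffs g) : HasPolyCoeffs fun p => f p * g p := by
  intro n
  simp only [coeff_mul]
  exact sum_mem_polyFunctions _ fun q _ => mul_mem (hf _) (hg _)

theorem HasPolyCoeffs.sub {f g : HomogData d → ℂ⟦X⟧} (hf : HasPolyCoeffs f)
    (hg : HasPolyCoeffs g) : HasPolyCoeffs fun p => f p - g p := by
  intro n
  simp only [map_sub]
  exact sub_mem (hf n) (hg n)

theorem hasPolyCoeffs_jetSeries {Z : HomogData d → Fin 4 → Fin 5 → ℂ}
    (h : ∀ k j, (fun p => Z p k j) ∈ polyFunctions d) (j : Fin 5) :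
    HasPolyCoeffs fun p => jetSeries (Z p) j := by
  intro n
  simp only [jetSeries, map_sum, coeff_monomial, div_eq_mul_inv]
  refine sum_mem_polyFunctions _ fun k _ => ?_
  split_ifs
  · exact mul_mem (h k j) (const_mem_polyFunctions _)
  · exact const_mem_polyFunctions _

theorem hasPolyCoeffs_evalJet (F : MvPolynomial (Fin 5) ℂ) :
    HasPolyCoeffs fun p : HomogData d => evalJet p.1 F := by
  induction F using MvPolynomial.induction_on with
  | C c =>
    intro n
    simpa using const_mem_polyFunctions _
  | add F G hF hG =>
    intro n
    simp only [map_add]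
    exact add_mem (hF n) (hG n)
  | mul_X F i hF =>
    simp only [map_mul, MvPolynomial.aeval_X]
    exact hF.mul (hasPolyCoeffs_jetSeries jet_mem_polyFunctions i)

/-! ### Equivariant vector fields on the cone -/

/-- Polynomial vector fields on the space of homogeneous data that are tangent to the jet cone and
equivariant, with weight `12`, under rescaling of the curve and of the coefficients. -/
structure IsHomogField (V : HomogData d → HomogData d) : Prop where
  regular_jet : ∀ k j, (fun p => (V p).1 k j) ∈ polyFunctions d
  regular_coeff : ∀ α, (fun p => (V p).2 α) ∈ polyFunctions d
  tangent : ∀ p, modX4 (evalJet p.1 (formOf d p.2)) = 0 → modX4 (formDifferential p (V p)) = 0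
  equivariant_jet : ∀ (p q : HomogData d) (lam : ℂ⟦X⟧) (mu : ℂ),
    (∀ j, modX4 (jetSeries q.1 j) = modX4 (lam * jetSeries p.1 j)) → q.2 = mu • p.2 →
    ∀ j, modX4 (jetSeries (V q).1 j) =
      modX4 (constantCoeff lam ^ 12 • (lam * jetSeries (V p).1 j))
  equivariant_coeff : ∀ (p q : HomogData d) (lam : ℂ⟦X⟧) (mu : ℂ),
    (∀ j, modX4 (jetSeries q.1 j) = modX4 (lam * jetSeries p.1 j)) → q.2 = mu • p.2 →
    (V q).2 = (constantCoeff lam ^ 12 * mu) • (V p).2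

theorem formDifferential_add (p v w : HomogData d) :
    formDifferential p (v + w) = formDifferential p v + formDifferential p w := by
  simp only [formDifferential, Prod.fst_add, Prod.snd_add, jetSeries_add, map_add, mul_add,
    Finset.sum_add_distrib]
  ring

theorem formDifferential_smul (p : HomogData d) (c : ℂ) (v : HomogData d) :
    formDifferential p (c • v) = c • formDifferential p v := by
  simp only [formDifferential, Prod.smul_fst, Prod.smul_snd, jetSeries_smul, map_smul,
    mul_smul_comm, ← Finset.smul_sum, smul_add]

/-- The space of equivariant vector fields on the cone. -/
def homogFields (d : ℕ) : Submodule ℂ (HomogData d → HomogData d) where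
  carrier := {V | IsHomogField V}
  zero_mem' :=
    { regular_jet := fun _ _ => const_mem_polyFunctions 0
      regular_coeff := fun _ => const_mem_polyFunctions 0
      tangent := fun p _ => by simp [formDifferential, jetSeries]
      equivariant_jet := fun p q lam mu _ _ j => by simp [jetSeries]
      equivariant_coeff := fun p q lam mu _ _ => by simp }
  add_mem' := by
    intro V W hV hW
    exact
    { regular_jet := fun k j => add_mem (hV.regular_jet k j) (hW.regular_jet k j)
      regular_coeff := fun α => add_mem (hV.regular_coeff α) (hW.regular_coeff α)
      tangent := fun p hp => by
        rw [Pi.add_apply, formDifferential_add, map_add, hV.tangent p hp, hW.tangent p hp, add_zero]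
      equivariant_jet := fun p q lam mu h1 h2 j => by
        simp only [Pi.add_apply, Prod.fst_add, jetSeries_add, mul_add, smul_add,
          map_add modX4, hV.equivariant_jet p q lam mu h1 h2 j,
          hW.equivariant_jet p q lam mu h1 h2 j]
      equivariant_coeff := fun p q lam mu h1 h2 => by
        simp only [Pi.add_apply, Prod.snd_add, hV.equivariant_coeff p q lam mu h1 h2,
          hW.equivariant_coeff p q lam mu h1 h2, smul_add] }
  smul_mem' := by
    intro c V hV
    exact
    { regular_jet := fun k j => mul_mem (const_mem_polyFunctions c) (hV.regular_jet k j)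
      regular_coeff := fun α => mul_mem (const_mem_polyFunctions c) (hV.regular_coeff α)
      tangent := fun p hp => by
        rw [Pi.smul_apply, formDifferential_smul, map_smul, hV.tangent p hp, smul_zero]
      equivariant_jet := fun p q lam mu h1 h2 j => by
        simp only [Pi.smul_apply, Prod.smul_fst, jetSeries_smul, map_smul,
          hV.equivariant_jet p q lam mu h1 h2 j, mul_smul_comm]
        rw [smul_comm]
      equivariant_coeff := fun p q lam mu h1 h2 => by
        simp only [Pi.smul_apply, Prod.smul_snd, hV.equivariant_coeff p q lam mu h1 h2]
        rw [smul_comm] }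

theorem jetSeries_eq_one {Z : Fin 4 → Fin 5 → ℂ} {i : Fin 5} (h0 : Z 0 i = 1)
    (h : ∀ k : Fin 4, k ≠ 0 → Z k i = 0) : jetSeries Z i = 1 := by
  rw [jetSeries, Finset.sum_eq_single 0]
  · simp [h0]
  · intro k _ hk
    simp [h k hk]
  · simp

/-- On normalized data the differential is the projection onto the slice `Z_i(t) = 1`, `a_β = 1`
along the rescaling orbits: an infinitesimal rescaling of `Z(t)` and one of `a` are subtracted. -/
theorem chartDifferential_of_normalized {i : Fin 5} {β : MultiIndex d} {p : HomogData d}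
    (hi : jetSeries p.1 i = 1) (hβ : p.2 β = 1) (v : HomogData d) :
    chartDifferential i β p v =
      (jetOf fun j => jetSeries v.1 j - jetSeries p.1 j * jetSeries v.1 i,
        v.2 - v.2 β • p.2) := by
  simp [chartDifferential, hi, hβ]

theorem toChart_normalized {j : Fin 5} {γ : MultiIndex d} {p : HomogData d} (hj : p.1 0 j ≠ 0)
    (hγ : p.2 γ ≠ 0) :
    (toChart j γ p).1 0 j = 1 ∧ (∀ k : Fin 4, k ≠ 0 → (toChart j γ p).1 k j = 0) ∧
      (toChart j γ p).2 γ = 1 := by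
  have h : jetSeries p.1 j * (jetSeries p.1 j)⁻¹ = 1 :=
    PowerSeries.mul_inv_cancel _ (by rwa [constantCoeff_jetSeries])
  refine ⟨?_, fun k hk => ?_, ?_⟩
  · simp [toChart, h]
  · simp only [toChart, h]
    have hk' : (k : ℕ) ≠ 0 := fun h => hk (Fin.ext h)
    simp [coeff_one, hk']
  · simp [toChart, hγ]

theorem modX4_toChart (i : Fin 5) (β : MultiIndex d) (p : HomogData d) (j : Fin 5) :
    modX4 (jetSeries (toChart i β p).1 j) =
      modX4 ((jetSeries p.1 i)⁻¹ * jetSeries p.1 j) := by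
  rw [mul_comm]
  exact modX4_jetSeries_jetOf (fun j => jetSeries p.1 j * (jetSeries p.1 i)⁻¹) j

/-- The twisted vector field on `J₃ᵛ(𝒳)` induced by an equivariant vector field on the cone. -/
def IsHomogField.toTwisted {V : HomogData d → HomogData d} (hV : IsHomogField V) :
    TwistedVectorField d 12 0 where
  field i β p := chartDifferential i β p (V p)
  regular_jet i β k j := by
    have h : HasPolyCoeffs fun p : HomogData d =>
        jetSeries (V p).1 j - jetSeries p.1 j * jetSeries (V p).1 i :=
      (hasPolyCoeffs_jetSeries hV.regular_jet j).sub
        ((hasPolyCoeffs_jetSeries jet_mem_polyFunctions j).mul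
          (hasPolyCoeffs_jetSeries hV.regular_jet i))
    obtain ⟨P, hP⟩ := isRegularOn_of_mem_polyFunctions
      (mul_mem (const_mem_polyFunctions ((k : ℕ)! : ℂ)) (h k)) (chart d i β)
    refine ⟨P, fun p hp => ?_⟩
    rw [← hP p hp]
    beta_reduce
    rw [chartDifferential_of_normalized (jetSeries_eq_one hp.2.1 hp.2.2.1) hp.2.2.2]
    rfl
  regular_coeff i β α := by
    obtain ⟨P, hP⟩ := isRegularOn_of_mem_polyFunctions
      (sub_mem (hV.regular_coeff α) (mul_mem (hV.regular_coeff β)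
        (coefficient_mem_polyFunctions α))) (chart d i β)
    refine ⟨P, fun p hp => ?_⟩
    rw [← hP p hp]
    beta_reduce
    rw [chartDifferential_of_normalized (jetSeries_eq_one hp.2.1 hp.2.2.1) hp.2.2.2]
    rfl
  tangent i β p hp := by
    have hi := jetSeries_eq_one hp.2.1 hp.2.2.1
    have hF := (jetEquations_iff p).1 hp.1.2.2
    have hT := hV.tangent p hF
    rw [chartDifferential_of_normalized hi hp.2.2.2, mem_tangentSpaceAt_iff]
    refine ⟨fun k => by simp [jetOf, hi], by simp [hp.2.2.2], ?_⟩
    -- By Euler's identity the subtracted rescaling of `Z(t)` changes the equation by a multiple of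
    -- the equation itself, hence by zero modulo `t⁴`.
    have hE := sum_aeval_pderiv_mul (isHomogeneous_formOf p.2) (jetSeries p.1)
    have hE' := congrArg modX4 hE
    simp only [formDifferential, map_add, map_sum, map_mul, map_sub, map_smul,
      modX4_jetSeries_jetOf, mul_sub, Finset.sum_sub_distrib] at hT hE' ⊢
    rw [hF] at hE' ⊢
    have e : ∑ j, modX4 (evalJet p.1 (MvPolynomial.pderiv j (formOf d p.2))) *
        (modX4 (jetSeries p.1 j) * modX4 (jetSeries (V p).1 i)) = 0 := by
      simp only [← mul_assoc, ← Finset.sum_mul, hE', mul_zero, zero_mul]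
    rw [e, smul_zero]
    linear_combination hT
  glue i β j γ p hp hj hγ := by
    obtain ⟨n1, n2, n3⟩ := toChart_normalized hj hγ
    have hi := jetSeries_eq_one hp.2.1 hp.2.2.1
    have hinv : jetSeries p.1 j * (jetSeries p.1 j)⁻¹ = 1 :=
      PowerSeries.mul_inv_cancel _ (by rwa [constantCoeff_jetSeries])
    have hq1 : ∀ l, modX4 (jetSeries (toChart j γ p).1 l) =
        modX4 ((jetSeries p.1 j)⁻¹ * jetSeries p.1 l) := modX4_toChart j γ p
    have hq2 : (toChart j γ p).2 = (p.2 γ)⁻¹ • p.2 := rfl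
    -- The coordinate change is the rescaling with `lam = Z_j(t)⁻¹` and `mu = a_γ⁻¹`, so `lam(0) ^
    -- 12` is the transition function of `𝒪(12)`.
    have e1 := hV.equivariant_jet p _ _ _ hq1 hq2
    have e2 := hV.equivariant_coeff p _ _ _ hq1 hq2
    rw [fderiv_toChart hj hγ, chartDifferential_of_normalized (jetSeries_eq_one n1 n2) n3,
      chartDifferential_of_normalized hi hp.2.2.2]
    simp only [constantCoeff_inv, constantCoeff_jetSeries] at e1 e2
    have hc : ((p.1 0 j)⁻¹ : ℂ) ^ (12 : ℤ) * ((p.2 γ)⁻¹) ^ (0 : ℤ) = (p.1 0 j)⁻¹ ^ 12 := by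
      rw [zpow_zero, mul_one]
      norm_cast
    rw [hc]
    refine Prod.ext (jetSeries_injective_modX4 fun l => ?_) ?_
    · simp only [chartDifferential, Prod.smul_fst, jetSeries_smul, map_smul, map_sub, map_mul,
        modX4_jetSeries_jetOf, e1, hq1]
      have h := congrArg modX4 hinv
      simp only [map_mul, map_one] at h
      simp only [mul_smul_comm, ← smul_sub]
      congr 1
      linear_combination modX4 (jetSeries p.1 l) * modX4 (jetSeries (V p).1 i) *
        modX4 (jetSeries p.1 j)⁻¹ * (-h)
    · funext α
      simp only [chartDifferential, Prod.smul_snd, e2, hq2, Pi.sub_apply, Pi.smul_apply,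
        smul_eq_mul]
      have h := mul_inv_cancel₀ hγ
      linear_combination (p.1 0 j)⁻¹ ^ 12 * (p.2 γ)⁻¹ * (V p).2 β * p.2 α * (-h)

/-- A vector tangent to the chart already lies in the slice, so the projection performed by
`toTwisted` leaves it unchanged. -/
theorem exists_twistedVectorField {i : Fin 5} {β : MultiIndex d} {p v : HomogData d}
    (hp : p ∈ chart d i β) (hv : v ∈ tangentSpaceAt i β p)
    (h : ∃ V ∈ homogFields d, V p = v) :
    ∃ s : TwistedVectorField d 12 0, s.field i β p = v := by
  obtain ⟨V, hV, rfl⟩ := h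
  refine ⟨IsHomogField.toTwisted hV, ?_⟩
  rw [mem_tangentSpaceAt_iff] at hv
  have h0 : jetSeries (V p).1 i = 0 := by simp [jetSeries, hv.1]
  change chartDifferential i β p (V p) = _
  rw [chartDifferential_of_normalized (jetSeries_eq_one hp.2.1 hp.2.2.1) hp.2.2.2, h0, hv.2.1]
  simp [jetOf_jetSeries]

end VerticalJets

end

/-! ### Equivariant fields and their values at nondegenerate jets. -/

noncomputable section

namespace VerticalJets

open PowerSeries

variable {d : ℕ}

/-! ### Multiplication of truncated series -/

/-- The first four coefficients of a series. -/
def coeffVec (f : ℂ⟦X⟧) : Fin 4 → ℂ := fun k => coeff (k : ℕ) f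

theorem modX4_eq_iff_coeffVec {f g : ℂ⟦X⟧} : modX4 f = modX4 g ↔ coeffVec f = coeffVec g := by
  rw [modX4_eq_iff_coeff, funext_iff]
  rfl

/-- The matrix of multiplication by `u` on series modulo `t⁴`. -/
def toeplitz (u : ℂ⟦X⟧) : Matrix (Fin 4) (Fin 4) ℂ :=
  Matrix.of fun k i => if (i : ℕ) ≤ k then coeff ((k : ℕ) - i) u else 0

theorem coeffVec_mul (u f : ℂ⟦X⟧) : coeffVec (u * f) = (toeplitz u).mulVec (coeffVec f) := by
  funext k
  simp only [coeffVec, toeplitz, Matrix.mulVec, dotProduct, Fin.sum_univ_four, Matrix.of_apply]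
  rw [mul_comm u f, coeff_mul, Finset.Nat.sum_antidiagonal_eq_sum_range_succ_mk]
  obtain ⟨k, hk⟩ := k
  interval_cases k <;> simp [Finset.sum_range_succ] <;> ring

/-- Source of the weights: with `u = lam ^ c`, a determinant of values of four forms of degree `c`
scales by `lam(0) ^ (4 * c)`, so the higher coefficients of `lam` disappear. -/
theorem det_toeplitz (u : ℂ⟦X⟧) : (toeplitz u).det = constantCoeff u ^ 4 := by
  rw [Matrix.det_of_isLowerTriangular]
  · simp [toeplitz]
  · intro i j hij
    exact if_neg (not_le.2 hij)

/-! ### The vector fields of the action of `GL₅` -/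

/-- The derivative of the form `F` along the linear vector field `M`. -/
def lieForm (M : Matrix (Fin 5) (Fin 5) ℂ) : MvPolynomial (Fin 5) ℂ →ₗ[ℂ] MvPolynomial (Fin 5) ℂ :=
  ∑ j, (LinearMap.mulLeft ℂ (∑ l, M j l • MvPolynomial.X l)).comp
    (MvPolynomial.pderiv (R := ℂ) j).toLinearMap

theorem lieForm_apply (M : Matrix (Fin 5) (Fin 5) ℂ) (F : MvPolynomial (Fin 5) ℂ) :
    lieForm M F = ∑ j, (∑ l, M j l • MvPolynomial.X l) * MvPolynomial.pderiv j F := by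
  simp [lieForm]

theorem isHomogeneous_linearForm (m : Fin 5 → ℂ) :
    (∑ l, m l • MvPolynomial.X l : MvPolynomial (Fin 5) ℂ).IsHomogeneous 1 := by
  refine MvPolynomial.IsHomogeneous.sum _ _ _ fun l _ => ?_
  rw [MvPolynomial.smul_eq_C_mul]
  exact (MvPolynomial.isHomogeneous_X ℂ l).C_mul (m l)

theorem isHomogeneous_lieForm (hd : 1 ≤ d) (M : Matrix (Fin 5) (Fin 5) ℂ)
    {F : MvPolynomial (Fin 5) ℂ} (hF : F.IsHomogeneous d) : (lieForm M F).IsHomogeneous d := by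
  rw [lieForm_apply]
  refine MvPolynomial.IsHomogeneous.sum _ _ _ fun j _ => ?_
  have h := (isHomogeneous_linearForm (M j)).mul (hF.pderiv (i := j))
  rwa [Nat.add_sub_cancel' hd] at h

theorem jetSeries_mulVec (M : Matrix (Fin 5) (Fin 5) ℂ) (Z : Fin 4 → Fin 5 → ℂ) (j : Fin 5) :
    jetSeries (fun k => M.mulVec (Z k)) j = ∑ l, M j l • jetSeries Z l := by
  simp only [jetSeries, Matrix.mulVec, dotProduct, Finset.smul_sum, Finset.sum_div, map_sum,
    ← map_smul, smul_eq_mul]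
  rw [Finset.sum_comm]
  simp only [mul_div_assoc]

/-- The vector field given by the infinitesimal action of a matrix on curves and forms. -/
def matrixField (M : Matrix (Fin 5) (Fin 5) ℂ) (i : Fin 5) (p : HomogData d) : HomogData d :=
  p.1 0 i ^ 12 • (fun k => M.mulVec (p.1 k), -coeffsOf d (lieForm M (formOf d p.2)))

theorem constantCoeff_of_modX4 {f g : ℂ⟦X⟧} (h : modX4 f = modX4 g) :
    constantCoeff f = constantCoeff g := by
  simpa using modX4_eq_iff_coeff.1 h 0

theorem scale_point {Z W : Fin 4 → Fin 5 → ℂ} {lam : ℂ⟦X⟧}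
    (h : ∀ j, modX4 (jetSeries W j) = modX4 (lam * jetSeries Z j)) (i : Fin 5) :
    W 0 i = constantCoeff lam * Z 0 i := by
  have := constantCoeff_of_modX4 (h i)
  rwa [map_mul, constantCoeff_jetSeries, constantCoeff_jetSeries] at this

theorem linear_mem_polyFunctions (L : (MultiIndex d → ℂ) →ₗ[ℂ] ℂ) :
    (fun p : HomogData d => L p.2) ∈ polyFunctions d := by
  rw [funext fun p : HomogData d => L.pi_apply_eq_sum_univ p.2]
  exact sum_mem_polyFunctions _ fun α _ =>
    mul_mem (coefficient_mem_polyFunctions α) (const_mem_polyFunctions _)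

/-- Acting on the curve by `M` and on the form by minus the induced derivation leaves `F(Z(t))`
unchanged to first order, so tangency is an identity at every `p`. The factor `Z_i ^ 12` only
provides the twist. -/
theorem matrixField_mem (hd : 1 ≤ d) (M : Matrix (Fin 5) (Fin 5) ℂ) (i : Fin 5) :
    matrixField M i ∈ homogFields d := by
  have hreg : (fun p : HomogData d => p.1 0 i ^ 12) ∈ polyFunctions d :=
    pow_mem (jet_mem_polyFunctions 0 i) 12
  exact
  { regular_jet := fun k j => by
      have h : (fun p : HomogData d => ∑ l, M j l * p.1 k l) ∈ polyFunctions d :=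
        sum_mem_polyFunctions _ fun l _ =>
          mul_mem (const_mem_polyFunctions _) (jet_mem_polyFunctions k l)
      exact mul_mem hreg h
    regular_coeff := fun α => mul_mem hreg (neg_mem (linear_mem_polyFunctions
      ((LinearMap.proj α).comp ((coeffsOf d).comp ((lieForm M).comp (formOf d))))))
    tangent := fun p _ => by
      rw [matrixField, formDifferential_smul]
      simp only [formDifferential, jetSeries_mulVec, map_neg,
        formOf_coeffsOf (isHomogeneous_lieForm hd M (isHomogeneous_formOf p.2))]
      rw [lieForm_apply]
      simp [mul_comm]
    equivariant_jet := fun p q lam mu h1 h2 j => by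
      simp only [matrixField, Prod.smul_fst, jetSeries_smul, jetSeries_mulVec, map_smul, map_sum,
        map_mul, h1, scale_point h1 i, mul_pow, mul_smul_comm, Finset.mul_sum, mul_smul]
    equivariant_coeff := fun p q lam mu h1 h2 => by
      simp only [matrixField, Prod.smul_snd, h2, map_smul, scale_point h1 i, mul_pow, smul_neg,
        smul_smul]
      congr 2
      ring }

/-! ### Vector fields moving only the coefficients -/

/-- The values at `t`-order at most `3` of four forms along the curve. -/
def valueMatrix (b : Fin 4 → MvPolynomial (Fin 5) ℂ) (Z : Fin 4 → Fin 5 → ℂ) :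
    Matrix (Fin 4) (Fin 4) ℂ :=
  Matrix.of fun k j => coeffVec (evalJet Z (b j)) k

/-- The combination of `v` and of four forms `b j`, given by Cramer's rule, that vanishes to order
`3` along the curve. -/
def cramerForm (b : Fin 4 → MvPolynomial (Fin 5) ℂ) (v : MvPolynomial (Fin 5) ℂ)
    (Z : Fin 4 → Fin 5 → ℂ) : MvPolynomial (Fin 5) ℂ :=
  (valueMatrix b Z).det • v -
    ∑ j, ((valueMatrix b Z).adjugate.mulVec (coeffVec (evalJet Z v))) j • b j

/-- This is `Φ * adj Φ = det Φ` for the value matrix `Φ`. Since nothing is divided by `det Φ`, it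
holds along every jet, including those where `Φ` is singular. -/
theorem modX4_evalJet_cramerForm (b : Fin 4 → MvPolynomial (Fin 5) ℂ) (v : MvPolynomial (Fin 5) ℂ)
    (Z : Fin 4 → Fin 5 → ℂ) : modX4 (evalJet Z (cramerForm b v Z)) = 0 := by
  have h : (valueMatrix b Z).mulVec
      ((valueMatrix b Z).adjugate.mulVec (coeffVec (evalJet Z v))) =
      (valueMatrix b Z).det • coeffVec (evalJet Z v) := by
    rw [Matrix.mulVec_mulVec, Matrix.mul_adjugate, Matrix.smul_mulVec, Matrix.one_mulVec]
  rw [modX4_eq_zero_iff_coeff]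
  intro k
  have hk := congrFun h k
  simp only [cramerForm, map_sub, map_smul, map_sum, smul_eq_mul, sub_eq_zero]
  simp only [Pi.smul_apply, smul_eq_mul] at hk
  refine hk.symm.trans ?_
  rw [Matrix.mulVec, dotProduct]
  exact Finset.sum_congr rfl fun j _ => mul_comm _ _

theorem isHomogeneous_cramerForm {c : ℕ} {b : Fin 4 → MvPolynomial (Fin 5) ℂ}
    {v : MvPolynomial (Fin 5) ℂ} (hb : ∀ j, (b j).IsHomogeneous c) (hv : v.IsHomogeneous c)
    (Z : Fin 4 → Fin 5 → ℂ) : (cramerForm b v Z).IsHomogeneous c :=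
  ((MvPolynomial.homogeneousSubmodule (Fin 5) ℂ c).sub_mem (Submodule.smul_mem _ _ hv)
    (Submodule.sum_mem _ fun j _ => Submodule.smul_mem _ _ (hb j)))

theorem coeffVec_evalJet_scale {c : ℕ} {f : MvPolynomial (Fin 5) ℂ} (hf : f.IsHomogeneous c)
    {Z W : Fin 4 → Fin 5 → ℂ} {lam : ℂ⟦X⟧}
    (h : ∀ j, modX4 (jetSeries W j) = modX4 (lam * jetSeries Z j)) :
    coeffVec (evalJet W f) = (toeplitz (lam ^ c)).mulVec (coeffVec (evalJet Z f)) := by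
  rw [← coeffVec_mul, ← modX4_eq_iff_coeffVec, ← aeval_mul_of_isHomogeneous hf, modX4_evalJet,
    ← AlgHom.comp_apply, MvPolynomial.comp_aeval]
  simp only [h]

/-- Rescaling multiplies the value matrix and the value vector on the left by the same `T`; since
`adj (T * Φ) * T = det T • adj Φ`, both terms of the form acquire the factor `det T`. -/
theorem cramerForm_scale {c : ℕ} {b : Fin 4 → MvPolynomial (Fin 5) ℂ}
    {v : MvPolynomial (Fin 5) ℂ} (hb : ∀ j, (b j).IsHomogeneous c) (hv : v.IsHomogeneous c)
    {Z W : Fin 4 → Fin 5 → ℂ} {lam : ℂ⟦X⟧}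
    (h : ∀ j, modX4 (jetSeries W j) = modX4 (lam * jetSeries Z j)) :
    cramerForm b v W = constantCoeff lam ^ (4 * c) • cramerForm b v Z := by
  set T := toeplitz (lam ^ c) with hT
  have hdet : T.det = constantCoeff lam ^ (4 * c) := by
    rw [hT, det_toeplitz, map_pow, ← pow_mul, mul_comm]
  have hΦ : valueMatrix b W = T * valueMatrix b Z := by
    ext k j
    exact congrFun (coeffVec_evalJet_scale (hb j) h) k
  have hadj : (valueMatrix b W).adjugate.mulVec (coeffVec (evalJet W v)) =
      T.det • (valueMatrix b Z).adjugate.mulVec (coeffVec (evalJet Z v)) := by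
    rw [hΦ, coeffVec_evalJet_scale hv h, Matrix.adjugate_mul_distrib, Matrix.mulVec_mulVec,
      Matrix.mul_assoc, ← hT, Matrix.adjugate_mul, Matrix.mul_smul, Matrix.mul_one,
      Matrix.smul_mulVec]
  rw [cramerForm, hadj, hΦ, Matrix.det_mul, hdet, cramerForm, smul_sub, Finset.smul_sum]
  simp only [Pi.smul_apply, smul_eq_mul, mul_smul]

/-- The vector field moving the coefficients along `G` times the form given by Cramer's rule. -/
def cramerField (b : Fin 4 → MvPolynomial (Fin 5) ℂ) (v G : MvPolynomial (Fin 5) ℂ) (s : ℕ)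
    (i : Fin 5) (δ : MultiIndex d) (p : HomogData d) : HomogData d :=
  (0, (p.1 0 i ^ s * p.2 δ) • coeffsOf d (G * cramerForm b v p.1))

/-- The curve is fixed and `a` moves along a form vanishing to order `3` on it, which gives
tangency. The factor `Z_i ^ s` completes the weight `4 * c` to `12`, and `a_δ` supplies the degree
one in `mu`. -/
theorem cramerField_mem {c r s : ℕ} (hcr : r + c = d) (hs : 4 * c + s = 12)
    {b : Fin 4 → MvPolynomial (Fin 5) ℂ} {v G : MvPolynomial (Fin 5) ℂ}
    (hb : ∀ j, (b j).IsHomogeneous c) (hv : v.IsHomogeneous c) (hG : G.IsHomogeneous r)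
    (i : Fin 5) (δ : MultiIndex d) : cramerField b v G s i δ ∈ homogFields d := by
  have hΦ : ∀ k j, (fun p : HomogData d => valueMatrix b p.1 k j) ∈ polyFunctions d :=
    fun k j => hasPolyCoeffs_evalJet (b j) k
  exact
  { regular_jet := fun k j => const_mem_polyFunctions 0
    regular_coeff := fun α => by
      refine mul_mem (mul_mem (pow_mem (jet_mem_polyFunctions 0 i) s)
        (coefficient_mem_polyFunctions δ)) ?_
      simp only [cramerForm, mul_sub, Finset.mul_sum, mul_smul_comm, map_sub, map_sum, map_smul,
        Pi.sub_apply, Finset.sum_apply, Pi.smul_apply, smul_eq_mul]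
      refine sub_mem (mul_mem (det_mem_polyFunctions hΦ) (const_mem_polyFunctions _))
        (sum_mem_polyFunctions _ fun j _ => mul_mem ?_ (const_mem_polyFunctions _))
      exact sum_mem_polyFunctions Finset.univ
        (f := fun l p => (valueMatrix b p.1).adjugate j l * coeffVec (evalJet p.1 v) l)
        fun l _ => mul_mem (adjugate_mem_polyFunctions hΦ j l) (hasPolyCoeffs_evalJet v l)
    tangent := fun p _ => by
      have hh := hG.mul (isHomogeneous_cramerForm hb hv p.1)
      rw [hcr] at hh
      simp only [cramerField, formDifferential, map_smul, formOf_coeffsOf hh, map_add, map_mul,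
        modX4_evalJet_cramerForm]
      simp [jetSeries]
    equivariant_jet := fun p q lam mu h1 h2 j => by simp [cramerField, jetSeries]
    equivariant_coeff := fun p q lam mu h1 h2 => by
      simp only [cramerField, cramerForm_scale hb hv h1, h2, scale_point h1 i, mul_smul_comm,
        map_smul, smul_smul, Pi.smul_apply, smul_eq_mul, ← hs]
      congr 1
      ring }

/-! ### Forms vanishing along a nondegenerate jet -/

/-- Forms of degree `n` vanishing to order `3` along the curve. -/
def vanishingForms (Z : Fin 4 → Fin 5 → ℂ) (n : ℕ) : Submodule ℂ (MvPolynomial (Fin 5) ℂ) :=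
  MvPolynomial.homogeneousSubmodule (Fin 5) ℂ n ⊓
    LinearMap.ker (modX4.comp (evalJet Z)).toLinearMap

theorem mem_vanishingForms {Z : Fin 4 → Fin 5 → ℂ} {n : ℕ} {f : MvPolynomial (Fin 5) ℂ} :
    f ∈ vanishingForms Z n ↔ f.IsHomogeneous n ∧ modX4 (evalJet Z f) = 0 := Iff.rfl

theorem exists_linearMap_of_linearIndependent {E : Type*} [AddCommGroup E] [Module ℂ E]
    {Z : Fin 4 → Fin 5 → ℂ} (hZ : LinearIndependent ℂ Z) (W : Fin 4 → E) :
    ∃ M : (Fin 5 → ℂ) →ₗ[ℂ] E, ∀ k, M (Z k) = W k := by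
  obtain ⟨g, hg⟩ := LinearMap.exists_leftInverse_of_injective (Fintype.linearCombination ℂ Z)
    (LinearMap.ker_eq_bot.2 hZ.fintypeLinearCombination_injective)
  refine ⟨(Fintype.linearCombination ℂ W).comp g, fun k => ?_⟩
  have h1 : Fintype.linearCombination ℂ Z (Pi.single k 1) = Z k := by
    simp [Fintype.linearCombination_apply_single]
  rw [← h1, LinearMap.comp_apply, ← LinearMap.comp_apply g, hg]
  simp [Fintype.linearCombination_apply_single]

/-- Linear forms restricting to `1, t, t², t³` on the curve. -/
structure IsAdapted (Z : Fin 4 → Fin 5 → ℂ) (l : Fin 4 → MvPolynomial (Fin 5) ℂ) : Prop where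
  isHomogeneous : ∀ k, (l k).IsHomogeneous 1
  evalJet : ∀ k, modX4 (evalJet Z (l k)) = modX4 (X ^ (k : ℕ))

theorem exists_isAdapted {Z : Fin 4 → Fin 5 → ℂ} (hZ : LinearIndependent ℂ Z) :
    ∃ l, IsAdapted Z l := by
  have h : ∀ k : Fin 4, ∃ l : MvPolynomial (Fin 5) ℂ, l.IsHomogeneous 1 ∧
      modX4 (VerticalJets.evalJet Z l) = modX4 (X ^ (k : ℕ)) := by
    intro k
    -- The value `k!` cancels the denominator in the Taylor coefficient `Z k / k!`.
    obtain ⟨m, hm⟩ := exists_linearMap_of_linearIndependent hZ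
      (Pi.single k ((k : ℕ)! : ℂ) : Fin 4 → ℂ)
    refine ⟨_, isHomogeneous_linearForm fun l => m (Pi.single l 1), ?_⟩
    rw [modX4_eq_iff_coeff]
    intro n
    have hn := hm n
    rw [m.pi_apply_eq_sum_univ] at hn
    simp only [map_sum, map_smul, MvPolynomial.aeval_X, coeff_jetSeries, smul_eq_mul, coeff_X_pow]
    have e : ∀ l : Fin 5, (fun j => if l = j then (1 : ℂ) else 0) = Pi.single l 1 := fun l => by
      funext j
      simp [Pi.single_apply, eq_comm]
    simp only [e, smul_eq_mul] at hn
    have : ∑ l, m (Pi.single l 1) * (Z n l / ((n : ℕ)! : ℂ)) =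
        (∑ l, Z n l * m (Pi.single l 1)) / ((n : ℕ)! : ℂ) := by
      rw [Finset.sum_div]
      exact Finset.sum_congr rfl fun l _ => by ring
    rw [this, hn]
    by_cases hnk : n = k
    · subst hnk
      simp [Nat.factorial_ne_zero]
    · rw [Pi.single_eq_of_ne hnk, zero_div, if_neg fun h => hnk (Fin.ext h)]
  choose l hl using h
  exact ⟨l, fun k => (hl k).1, fun k => (hl k).2⟩

/-- As `l 0` restricts to `1`, its powers raise the degree without changing the restriction: in
every positive degree four forms restrict to the basis `1, t, t², t³`. -/
theorem evalJet_pow_mul {Z : Fin 4 → Fin 5 → ℂ} {l : Fin 4 → MvPolynomial (Fin 5) ℂ}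
    (hl : IsAdapted Z l) (n : ℕ) (k : Fin 4) :
    modX4 (evalJet Z (l 0 ^ n * l k)) = modX4 (X ^ (k : ℕ)) := by
  rw [map_mul, map_mul, map_pow, map_pow, hl.evalJet, hl.evalJet]
  simp

theorem modX4_sum_X_pow (c : Fin 4 → ℂ) (f : ℂ⟦X⟧) :
    modX4 f = ∑ k, c k • modX4 (X ^ (k : ℕ)) ↔ coeffVec f = c := by
  simp only [← map_smul, ← map_sum]
  rw [modX4_eq_iff_coeffVec]
  have : coeffVec (∑ k : Fin 4, c k • (X : ℂ⟦X⟧) ^ (k : ℕ)) = c := by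
    funext n
    simp [coeffVec, coeff_X_pow, Fin.val_inj]
  rw [this]

theorem isHomogeneous_pow_mul {Z : Fin 4 → Fin 5 → ℂ} {l : Fin 4 → MvPolynomial (Fin 5) ℂ}
    (hl : IsAdapted Z l) (n : ℕ) (k : Fin 4) : (l 0 ^ n * l k).IsHomogeneous (n + 1) := by
  have := ((hl.isHomogeneous 0).pow n).mul (hl.isHomogeneous k)
  rwa [one_mul] at this

theorem sub_mem_vanishingForms {Z : Fin 4 → Fin 5 → ℂ} {l : Fin 4 → MvPolynomial (Fin 5) ℂ}
    (hl : IsAdapted Z l) {n : ℕ} {f : MvPolynomial (Fin 5) ℂ} (hf : f.IsHomogeneous (n + 1)) :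
    f - ∑ k, coeffVec (evalJet Z f) k • (l 0 ^ n * l k) ∈ vanishingForms Z (n + 1) := by
  refine ⟨Submodule.sub_mem _ hf (Submodule.sum_mem _ fun k _ =>
    Submodule.smul_mem _ _ (isHomogeneous_pow_mul hl n k)), ?_⟩
  change modX4 (evalJet Z _) = 0
  simp only [map_sub, map_sum, map_smul, evalJet_pow_mul hl, sub_eq_zero]
  exact (modX4_sum_X_pow _ _).2 rfl

/-- A normal form modulo the vanishing quadrics. In the induction a linear factor `m` is split off;
the products `m * l k` that arise are rewritten as combinations of the `l 0 * l j`, at the cost of a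
vanishing quadric. -/
theorem exists_sub_mem_mul_vanishingForms {Z : Fin 4 → Fin 5 → ℂ}
    {l : Fin 4 → MvPolynomial (Fin 5) ℂ} (hl : IsAdapted Z l) (r : ℕ)
    {f : MvPolynomial (Fin 5) ℂ} (hf : f.IsHomogeneous (r + 2)) :
    ∃ c : Fin 4 → ℂ, f - ∑ k, c k • (l 0 ^ (r + 1) * l k) ∈
      MvPolynomial.homogeneousSubmodule (Fin 5) ℂ r * vanishingForms Z 2 := by
  induction r generalizing f with
  | zero =>
    refine ⟨coeffVec (evalJet Z f), ?_⟩
    have h := Submodule.mul_mem_mul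
      (show (1 : MvPolynomial (Fin 5) ℂ) ∈ MvPolynomial.homogeneousSubmodule (Fin 5) ℂ 0 from
        MvPolynomial.isHomogeneous_one _ _) (sub_mem_vanishingForms hl (n := 1) hf)
    rwa [one_mul] at h
  | succ r ih =>
    -- Forms of degree `r + 3` are sums of products of a linear form and a form of degree `r + 2`.
    have hf' : f ∈ MvPolynomial.homogeneousSubmodule (Fin 5) ℂ 1 *
        MvPolynomial.homogeneousSubmodule (Fin 5) ℂ (r + 2) := by
      rw [← MvPolynomial.homogeneousSubmodule_one_pow (σ := Fin 5) (R := ℂ) (r + 2), ← pow_succ',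
        MvPolynomial.homogeneousSubmodule_one_pow]
      exact hf
    clear hf
    induction hf' using Submodule.mul_induction_on' with
    | mem_mul_mem m hm g hg =>
      obtain ⟨c, hc⟩ := ih hg
      set e : Fin 4 → Fin 4 → ℂ := fun k => coeffVec (evalJet Z (m * l k)) with he
      have hq : ∀ k, m * l k - ∑ j, e k j • (l 0 ^ 1 * l j) ∈ vanishingForms Z 2 := fun k =>
        sub_mem_vanishingForms hl (n := 1) (MvPolynomial.IsHomogeneous.mul hm (hl.isHomogeneous k))
      refine ⟨fun j => ∑ k, c k * e k j, ?_⟩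
      have key : m * g - ∑ j, (∑ k, c k * e k j) • (l 0 ^ (r + 1 + 1) * l j) =
          m * (g - ∑ k, c k • (l 0 ^ (r + 1) * l k)) +
            ∑ k, c k • (l 0 ^ (r + 1) * (m * l k - ∑ j, e k j • (l 0 ^ 1 * l j))) := by
        simp only [mul_sub, smul_sub, Finset.sum_sub_distrib, Finset.mul_sum, Finset.smul_sum,
          Finset.sum_smul, mul_smul_comm, smul_smul]
        rw [Finset.sum_comm (s := Finset.univ) (t := Finset.univ)
          (f := fun j k => (c k * e k j) • (l 0 ^ (r + 1 + 1) * l j))]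
        have e1 : ∀ k, m * (l 0 ^ (r + 1) * l k) = l 0 ^ (r + 1) * (m * l k) := fun k => by ring
        have e2 : ∀ j, l 0 ^ (r + 1) * (l 0 ^ 1 * l j) = l 0 ^ (r + 1 + 1) * l j :=
          fun j => by ring
        simp only [e1, e2]
        ring
      rw [key]
      refine Submodule.add_mem _ ?_ (Submodule.sum_mem _ fun k _ => Submodule.smul_mem _ _
        (Submodule.mul_mem_mul ?_ (hq k)))
      · have h := Submodule.mul_mem_mul hm hc
        rw [← mul_assoc] at h
        refine (mul_le_mul' ?_ le_rfl :
          MvPolynomial.homogeneousSubmodule (Fin 5) ℂ 1 *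
            MvPolynomial.homogeneousSubmodule (Fin 5) ℂ r * vanishingForms Z 2 ≤ _) h
        rw [add_comm r 1]
        exact MvPolynomial.homogeneousSubmodule_mul 1 r
      · have := (hl.isHomogeneous 0).pow (r + 1)
        rwa [one_mul] at this
    | add f _ g _ hf1 hg1 =>
      obtain ⟨c, hc⟩ := hf1
      obtain ⟨e, he⟩ := hg1
      refine ⟨c + e, ?_⟩
      convert Submodule.add_mem _ hc he using 1
      simp only [Pi.add_apply, add_smul, Finset.sum_add_distrib]
      ring

/-- Along a nondegenerate jet, the vanishing forms are generated by the quadrics among them. -/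
theorem vanishingForms_le_mul {Z : Fin 4 → Fin 5 → ℂ} {l : Fin 4 → MvPolynomial (Fin 5) ℂ}
    (hl : IsAdapted Z l) (r : ℕ) : vanishingForms Z (r + 2) ≤
      MvPolynomial.homogeneousSubmodule (Fin 5) ℂ r * vanishingForms Z 2 := by
  intro f hf
  obtain ⟨hf1, hf2⟩ := mem_vanishingForms.1 hf
  obtain ⟨c, hc⟩ := exists_sub_mem_mul_vanishingForms hl r hf1
  have hker : MvPolynomial.homogeneousSubmodule (Fin 5) ℂ r * vanishingForms Z 2 ≤
      LinearMap.ker (modX4.comp (evalJet Z)).toLinearMap := by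
    rw [Submodule.mul_le]
    intro G _ v hv
    change modX4 (evalJet Z (G * v)) = 0
    rw [map_mul, map_mul, (mem_vanishingForms.1 hv).2, mul_zero]
  have h0 : modX4 (evalJet Z (f - ∑ k, c k • (l 0 ^ (r + 1) * l k))) = 0 := hker hc
  simp only [map_sub, map_sum, map_smul, evalJet_pow_mul hl] at h0
  -- On the curve the normal form becomes `∑ c k • tᵏ`, which must vanish modulo `t⁴` because `f`
  -- does.
  have hc0 : c = 0 := by
    rw [← (modX4_sum_X_pow _ _).1 (sub_eq_zero.1 h0), ← modX4_sum_X_pow, hf2]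
    simp
  simpa [hc0] using hc

/-! ### Values of the equivariant vector fields -/

/-- The values at `p` of the equivariant vector fields. -/
def fieldValues (p : HomogData d) : Submodule ℂ (HomogData d) :=
  (homogFields d).map (LinearMap.proj p)

/-- The auxiliary forms `l 0 ^ n * l k` are chosen from the given `p` and then kept fixed. At `p`
their value matrix is the identity and `v` has zero value vector, so the Cramer form is `v` itself.
The bound `n ≤ 2` says that the weight `4 * (n + 1)` is at most `12`. -/
theorem coeffsOf_mul_mem_fieldValues {p : HomogData d} {i : Fin 5} {δ : MultiIndex d}
    (hi : p.1 0 i = 1) (hδ : p.2 δ = 1) {l : Fin 4 → MvPolynomial (Fin 5) ℂ}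
    (hl : IsAdapted p.1 l) {n r : ℕ} (hn : n ≤ 2) (hnr : r + (n + 1) = d)
    {G v : MvPolynomial (Fin 5) ℂ} (hG : G.IsHomogeneous r)
    (hv : v ∈ vanishingForms p.1 (n + 1)) :
    ((0, coeffsOf d (G * v)) : HomogData d) ∈ fieldValues p := by
  refine ⟨cramerField (fun k => l 0 ^ n * l k) v G (12 - 4 * (n + 1)) i δ,
    cramerField_mem hnr (by omega) (isHomogeneous_pow_mul hl n) hv.1 hG i δ, ?_⟩
  have h1 : valueMatrix (fun k => l 0 ^ n * l k) p.1 = 1 := by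
    ext k j
    have := modX4_eq_iff_coeff.1 (evalJet_pow_mul hl n j) k
    change coeff (k : ℕ) (evalJet p.1 (l 0 ^ n * l j)) = _
    rw [this, coeff_X_pow, Matrix.one_apply]
    simp only [Fin.val_inj]
  have h2 : coeffVec (evalJet p.1 v) = 0 := by
    funext k
    exact modX4_eq_zero_iff_coeff.1 hv.2 k
  simp [cramerField, cramerForm, h1, h2, hi, hδ]

theorem coeffsOf_mem_fieldValues (hd : 1 ≤ d) {p : HomogData d} {i : Fin 5} {δ : MultiIndex d}
    (hi : p.1 0 i = 1) (hδ : p.2 δ = 1) (hp : LinearIndependent ℂ p.1)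
    {f : MvPolynomial (Fin 5) ℂ} (hf : f ∈ vanishingForms p.1 d) :
    ((0, coeffsOf d f) : HomogData d) ∈ fieldValues p := by
  obtain ⟨l, hl⟩ := exists_isAdapted hp
  obtain rfl | ⟨r, rfl⟩ : d = 1 ∨ ∃ r, d = r + 2 := by
    rcases d with _ | _ | r
    · omega
    · exact Or.inl rfl
    · exact Or.inr ⟨r, rfl⟩
  · simpa using coeffsOf_mul_mem_fieldValues hi hδ hl (n := 0) (r := 0) (by omega) rfl
      (MvPolynomial.isHomogeneous_one _ _) hf
  · have hle : MvPolynomial.homogeneousSubmodule (Fin 5) ℂ r * vanishingForms p.1 2 ≤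
        (fieldValues p).comap ((LinearMap.inr ℂ _ _).comp (coeffsOf (r + 2))) := by
      rw [Submodule.mul_le]
      intro G hG v hv
      exact coeffsOf_mul_mem_fieldValues hi hδ hl (n := 1) (r := r) (by omega) rfl hG hv
    exact hle (vanishingForms_le_mul hl r hf)

/-- At a nondegenerate jet, the equivariant vector fields take all tangent values. -/
theorem mem_fieldValues (hd : 1 ≤ d) {p v : HomogData d} {i : Fin 5} {δ : MultiIndex d}
    (hi : p.1 0 i = 1) (hδ : p.2 δ = 1) (hF : modX4 (evalJet p.1 (formOf d p.2)) = 0)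
    (hp : LinearIndependent ℂ p.1) (hv : modX4 (formDifferential p v) = 0) :
    v ∈ fieldValues p := by
  -- Nondegeneracy allows a matrix sending each `Z k` to the prescribed jet component of `v`.
  obtain ⟨M, hM⟩ := exists_linearMap_of_linearIndependent hp v.1
  have hV := matrixField_mem hd (LinearMap.toMatrix' M) i
  have hV1 : (matrixField (LinearMap.toMatrix' M) i p).1 = v.1 := by
    funext k
    simp [matrixField, hi, LinearMap.toMatrix'_mulVec, hM]
  set w := matrixField (LinearMap.toMatrix' M) i p with hw
  have hwT : modX4 (formDifferential p w) = 0 := IsHomogField.tangent hV p hF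
  have hdiff : formOf d (v.2 - w.2) ∈ vanishingForms p.1 d := by
    refine ⟨isHomogeneous_formOf _, ?_⟩
    change modX4 (evalJet p.1 (formOf d (v.2 - w.2))) = 0
    -- The jet components of `v` and `w` agree, so only the coefficient parts of the two
    -- differentials survive.
    have e : evalJet p.1 (formOf d (v.2 - w.2)) = formDifferential p v - formDifferential p w := by
      rw [formDifferential, formDifferential, hV1, map_sub, map_sub]
      ring
    rw [e, map_sub, hv, hwT, sub_zero]
  have h := coeffsOf_mem_fieldValues hd hi hδ hp hdiff
  rw [coeffsOf_formOf] at h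
  have hs := Submodule.add_mem _ (⟨_, hV, rfl⟩ : w ∈ fieldValues p) h
  convert hs using 1
  refine Prod.ext ?_ ?_
  · simp [hV1]
  · simp

end VerticalJets

end

/-! ### Degenerate jets lie in `Σ`. -/

noncomputable section

namespace VerticalJets

open PowerSeries

variable {d : ℕ}

/-! ### Degenerate jets in the distinguished chart -/

/-- Multiplication by the unit `u` acts invertibly on the four Taylor coefficients, so a relation
among the `Z k` transfers to the `W k`. There the `i`-th coordinates are `1, 0, 0, 0`, which removes
`W 0` from the relation. -/
theorem linearIndependent_of_normalized {Z W : Fin 4 → Fin 5 → ℂ} {u : ℂ⟦X⟧} {i : Fin 5}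
    (hu : constantCoeff u ≠ 0)
    (h : ∀ j, modX4 (jetSeries Z j) = modX4 (u * jetSeries W j)) (hi : jetSeries W i = 1)
    (hW : LinearIndependent ℂ ![W 1, W 2, W 3]) : LinearIndependent ℂ Z := by
  rw [Fintype.linearIndependent_iff]
  intro g hg
  -- The factorials turn a relation among derivatives into one among Taylor coefficients.
  set b : Fin 4 → ℂ := fun k => g k * ((k : ℕ)! : ℂ) with hb
  have hZ : ∀ j, dotProduct b (coeffVec (jetSeries Z j)) = 0 := by
    intro j
    have := congrFun hg j
    simp only [Finset.sum_apply, Pi.smul_apply, smul_eq_mul, Pi.zero_apply] at this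
    rw [← this]
    refine Finset.sum_congr rfl fun k _ => ?_
    rw [coeffVec, coeff_jetSeries, hb]
    field_simp [factorial_cast_ne_zero k]
  set c := Matrix.vecMul b (toeplitz u) with hc
  have hcW : ∀ j, dotProduct c (coeffVec (jetSeries W j)) = 0 := by
    intro j
    rw [hc, ← Matrix.dotProduct_mulVec, ← coeffVec_mul, ← modX4_eq_iff_coeffVec.1 (h j), hZ]
  have c0 : c 0 = 0 := by
    have := hcW i
    rw [hi] at this
    simpa [dotProduct, coeffVec, Fin.sum_univ_four, coeff_one] using this
  have hc' : ∀ k : Fin 3, c k.succ / ((k.succ : Fin 4) : ℕ)! = 0 := by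
    refine Fintype.linearIndependent_iff.1 hW _ ?_
    funext j
    have := hcW j
    simp only [dotProduct, coeffVec, coeff_jetSeries] at this
    rw [Fin.sum_univ_succ, c0, zero_mul, zero_add] at this
    rw [Finset.sum_apply, Pi.zero_apply, ← this]
    refine Finset.sum_congr rfl fun k _ => ?_
    have hk : (![W 1, W 2, W 3] : Fin 3 → Fin 5 → ℂ) k = W k.succ := by
      fin_cases k <;> rfl
    rw [Pi.smul_apply, hk, smul_eq_mul]
    ring
  have hc0 : c = 0 := by
    funext k
    refine Fin.cases c0 (fun k => ?_) k
    exact (div_eq_zero_iff.1 (hc' k)).resolve_right (factorial_cast_ne_zero _)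
  have hb0 : b = 0 := Matrix.eq_zero_of_vecMul_eq_zero
    (by rw [det_toeplitz]; exact pow_ne_zero _ hu) hc0
  intro k
  exact (mul_eq_zero.1 (congrFun hb0 k)).resolve_right (factorial_cast_ne_zero _)

theorem modX4_evalJet_scale {F : MvPolynomial (Fin 5) ℂ} (hF : F.IsHomogeneous d)
    {Z W : Fin 4 → Fin 5 → ℂ} {lam : ℂ⟦X⟧}
    (h : ∀ j, modX4 (jetSeries W j) = modX4 (lam * jetSeries Z j)) :
    modX4 (evalJet W F) = modX4 lam ^ d * modX4 (evalJet Z F) := by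
  rw [modX4_eq_iff_coeffVec.2 ((coeffVec_evalJet_scale hF h).trans (coeffVec_mul _ _).symm),
    map_mul, map_pow]

theorem toChart_mem_chart {i : Fin 5} {β : MultiIndex d} {p : HomogData d} (hp : p ∈ jetCone d)
    (hi : p.1 0 i ≠ 0) (hβ : p.2 β ≠ 0) : toChart i β p ∈ chart d i β := by
  obtain ⟨n1, n2, n3⟩ := toChart_normalized hi hβ
  refine ⟨⟨fun h => ?_, fun h => ?_, ?_⟩, n1, n2, n3⟩
  · rw [h] at n1
    simp at n1
  · rw [h] at n3
    simp at n3
  · rw [jetEquations_iff, modX4_evalJet_scale (isHomogeneous_formOf _) (modX4_toChart i β p)]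
    change _ * modX4 (evalJet p.1 (formOf d ((p.2 β)⁻¹ • p.2))) = 0
    rw [map_smul, map_smul, map_smul, (jetEquations_iff p).1 hp.2.2, smul_zero, mul_zero]

theorem mk_eq_mk_toChart {i : Fin 5} {β : MultiIndex d} (p : jetCone d) (hi : p.1.1 0 i ≠ 0)
    (hβ : p.1.2 β ≠ 0) :
    Quotient.mk (jetSetoid d) p =
      Quotient.mk (jetSetoid d) ⟨toChart i β p.1, (toChart_mem_chart p.2 hi hβ).1⟩ := by
  have hinv : jetSeries p.1.1 i * (jetSeries p.1.1 i)⁻¹ = 1 :=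
    PowerSeries.mul_inv_cancel _ (by rwa [constantCoeff_jetSeries])
  refine Quotient.sound ⟨⟨⟨(jetSeries p.1.1 i)⁻¹, jetSeries p.1.1 i, ?_, hinv⟩, fun j => ?_⟩,
    Units.mk0 _ (inv_ne_zero hβ), rfl⟩
  · rw [mul_comm, hinv]
  · exact modX4_eq_iff_dvd.1 (modX4_toChart i β p.1 j)

theorem mem_sigmaZero {p : jetCone d} (h0 : p.1.1 0 0 ≠ 0) (ha : p.1.2 (pureIndex d) ≠ 0)
    (hp : ¬ LinearIndependent ℂ p.1.1) : Quotient.mk (jetSetoid d) p ∈ sigmaZero d := by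
  refine ⟨⟨_, (toChart_mem_chart p.2 h0 ha).1⟩, toChart_mem_chart p.2 h0 ha,
    mk_eq_mk_toChart p h0 ha, ?_⟩
  refine AlternatingMap.map_linearDependent _ _ fun hW => hp ?_
  obtain ⟨n1, n2, -⟩ := toChart_normalized h0 ha
  have hu : constantCoeff (jetSeries p.1.1 0) ≠ 0 := by rwa [constantCoeff_jetSeries]
  refine linearIndependent_of_normalized hu (fun j => ?_) (jetSeries_eq_one n1 n2) hW
  rw [map_mul, modX4_toChart, map_mul, ← mul_assoc, ← map_mul, PowerSeries.mul_inv_cancel _ hu,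
    map_one, one_mul]

/-! ### Moving degenerate jets into the distinguished chart -/

/-- The substitution `z ↦ z + s (y · z) x` in polynomials. -/
def transvect (x y : Fin 5 → ℂ) (s : ℂ) : MvPolynomial (Fin 5) ℂ →ₐ[ℂ] MvPolynomial (Fin 5) ℂ :=
  MvPolynomial.aeval fun j => MvPolynomial.X j + (s * x j) • ∑ l, y l • MvPolynomial.X l

theorem isHomogeneous_transvect (x y : Fin 5 → ℂ) (s : ℂ) {F : MvPolynomial (Fin 5) ℂ}
    (hF : F.IsHomogeneous d) : (transvect x y s F).IsHomogeneous d := by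
  have h := hF.aeval (S := ℂ)
    (fun j => MvPolynomial.X j + (s * x j) • ∑ l, y l • MvPolynomial.X l)
    (fun j => (MvPolynomial.isHomogeneous_X ℂ j).add
      (Submodule.smul_mem (MvPolynomial.homogeneousSubmodule (Fin 5) ℂ 1) _
        (isHomogeneous_linearForm y)))
  rwa [one_mul] at h

theorem aeval_transvect {A : Type*} [CommRing A] [Algebra ℂ A] (x y : Fin 5 → ℂ) (s : ℂ)
    (z : Fin 5 → A) (F : MvPolynomial (Fin 5) ℂ) :
    MvPolynomial.aeval z (transvect x y s F) =
      MvPolynomial.aeval (fun j => z j + (s * x j) • ∑ l, y l • z l) F := by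
  rw [transvect, ← AlgHom.comp_apply, MvPolynomial.comp_aeval]
  simp

theorem transvect_zero (x y : Fin 5 → ℂ) (F : MvPolynomial (Fin 5) ℂ) :
    transvect x y 0 F = F := by
  simp [transvect]

theorem continuous_coeff_transvect (x y : Fin 5 → ℂ) (F : MvPolynomial (Fin 5) ℂ)
    (m : Fin 5 →₀ ℕ) : Continuous fun s => (transvect x y s F).coeff m := by
  classical
  induction F using MvPolynomial.induction_on generalizing m with
  | C c => simpa [transvect] using continuous_const
  | add F G hF hG =>
    simp only [map_add, MvPolynomial.coeff_add]
    exact (hF m).add (hG m)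
  | mul_X F j hF =>
    simp only [map_mul, MvPolynomial.coeff_mul]
    refine continuous_finsetSum _ fun q _ => (hF q.1).mul ?_
    simp only [transvect, MvPolynomial.aeval_X, MvPolynomial.coeff_add, MvPolynomial.coeff_smul]
    fun_prop

/-- The curve of data through `p` obtained from the transformations `z ↦ z + s (y · z) x` of forms
and the inverse transformations of curves. -/
def transvectPath (x y : Fin 5 → ℂ) (p : HomogData d) (s : ℂ) : HomogData d :=
  (fun k => (1 + s * dotProduct y x) • p.1 k - (s * dotProduct y (p.1 k)) • x,
    coeffsOf d (transvect x y s (formOf d p.2)))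

theorem continuous_transvectPath (x y : Fin 5 → ℂ) (p : HomogData d) :
    Continuous (transvectPath x y p) := by
  refine Continuous.prodMk ?_ (continuous_pi fun α => continuous_coeff_transvect _ _ _ _)
  refine continuous_pi fun k => ?_
  fun_prop

theorem transvectPath_zero (x y : Fin 5 → ℂ) (p : HomogData d) : transvectPath x y p 0 = p := by
  simp [transvectPath, transvect_zero, coeffsOf_formOf]

theorem not_linearIndependent_transvectPath (x y : Fin 5 → ℂ) {p : HomogData d}
    (hp : ¬ LinearIndependent ℂ p.1) (s : ℂ) :
    ¬ LinearIndependent ℂ (transvectPath x y p s).1 := by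
  intro h
  set g : (Fin 5 → ℂ) →ₗ[ℂ] (Fin 5 → ℂ) :=
    (1 + s * dotProduct y x) • LinearMap.id -
      s • ((dotProductBilin ℂ ℂ y).smulRight x) with hg
  refine hp (LinearIndependent.of_comp g ?_)
  convert h using 1
  funext k
  simp [hg, transvectPath, mul_smul]

theorem jetSeries_transvectPath (x y : Fin 5 → ℂ) (p : HomogData d) (s : ℂ) (j : Fin 5) :
    jetSeries (transvectPath x y p s).1 j =
      (1 + s * dotProduct y x) • jetSeries p.1 j - (s * x j) • ∑ l, y l • jetSeries p.1 l := by
  ext n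
  simp only [jetSeries, transvectPath, map_sub, map_sum, map_smul, coeff_monomial, Pi.sub_apply,
    Pi.smul_apply, smul_eq_mul, Finset.mul_sum, dotProduct, Finset.sum_mul]
  rw [Finset.sum_comm (s := Finset.univ (α := Fin 5)), ← Finset.sum_sub_distrib]
  refine Finset.sum_congr rfl fun k _ => ?_
  split_ifs
  · rw [sub_div, Finset.sum_div]
    congr 1
    · ring
    · exact Finset.sum_congr rfl fun l _ => by ring
  · simp

/-- The curve is transformed by `(1 + s y·x) - s x yᵀ`, the inverse of `1 + s x yᵀ` with its
denominator cleared. The two changes compose to the scalar `1 + s y·x`, so by homogeneity the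
pulled-back form is only multiplied by a constant. -/
theorem jetEquation_transvectPath (x y : Fin 5 → ℂ) {p : HomogData d}
    (hp : ∀ k, jetEquation k p = 0) (s : ℂ) (k : Fin 4) :
    jetEquation k (transvectPath x y p s) = 0 := by
  revert k
  rw [jetEquations_iff] at hp ⊢
  have hF := isHomogeneous_formOf p.2
  change modX4 (MvPolynomial.aeval _ (formOf d (coeffsOf d (transvect x y s (formOf d p.2))))) = 0
  rw [formOf_coeffsOf (isHomogeneous_transvect x y s hF), aeval_transvect]
  have e : (fun j => jetSeries (transvectPath x y p s).1 j +
      (s * x j) • ∑ l, y l • jetSeries (transvectPath x y p s).1 l) =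
      fun j => algebraMap ℂ ℂ⟦X⟧ (1 + s * dotProduct y x) * jetSeries p.1 j := by
    funext j
    have h : ∑ l, y l • jetSeries (transvectPath x y p s).1 l = ∑ l, y l • jetSeries p.1 l := by
      simp only [jetSeries_transvectPath, smul_sub, Finset.sum_sub_distrib, smul_smul]
      have h1 : ∑ l, (y l * (1 + s * dotProduct y x)) • jetSeries p.1 l =
          (1 + s * dotProduct y x) • ∑ l, y l • jetSeries p.1 l := by
        simp only [Finset.smul_sum, smul_smul, mul_comm]
      have h2 : ∑ l, (y l * (s * x l)) • ∑ l, y l • jetSeries p.1 l =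
          (s * dotProduct y x) • ∑ l, y l • jetSeries p.1 l := by
        rw [← Finset.sum_smul, dotProduct, Finset.mul_sum]
        congr 1
        exact Finset.sum_congr rfl fun l _ => by ring
      rw [h1, h2, ← sub_smul]
      simp
    rw [h, jetSeries_transvectPath, sub_add_cancel, Algebra.smul_def]
  rw [e, aeval_mul_of_isHomogeneous hF, map_mul, hp, mul_zero]

theorem coeffsOf_pureIndex {F : MvPolynomial (Fin 5) ℂ} (hF : F.IsHomogeneous d) :
    coeffsOf d F (pureIndex d) = MvPolynomial.eval (Pi.single 1 1) F := by
  conv_rhs => rw [← formOf_coeffsOf hF]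
  rw [formOf_apply, map_sum, Finset.sum_eq_single (pureIndex d)]
  · rw [MvPolynomial.eval_monomial, Finsupp.prod_fintype _ _ (by simp)]
    rw [Finset.prod_eq_single 1]
    · simp
    · intro j _ hj
      simp [pureIndex, hj]
    · simp
  · intro α _ hα
    rw [MvPolynomial.eval_monomial, Finsupp.prod_fintype _ _ (by simp)]
    obtain ⟨j, hj, hj'⟩ : ∃ j, j ≠ 1 ∧ α.1 j ≠ 0 := by
      by_contra! hcon
      refine hα (Subtype.ext (funext fun j => ?_))
      have hs := (Finset.mem_piAntidiag.1 α.2).1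
      rw [Finset.sum_eq_single 1 (fun j _ hj => hcon j hj) (by simp)] at hs
      by_cases hj : j = 1
      · subst hj
        simp [pureIndex, hs]
      · simp [pureIndex, hj, hcon j hj]
    rw [Finset.prod_eq_zero (Finset.mem_univ j), mul_zero]
    simp [hj, hj']
  · simp

theorem exists_eval_ne_zero {F : MvPolynomial (Fin 5) ℂ} (hF : F ≠ 0) :
    ∃ u, MvPolynomial.eval u F ≠ 0 := by
  by_contra! h
  exact hF (MvPolynomial.funext fun u => by simp [h u])

theorem eventually_eval_ne_zero {P : Polynomial ℂ} (hP : P ≠ 0) :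
    ∀ᶠ s in nhdsWithin (0 : ℂ) {0}ᶜ, P.eval s ≠ 0 := by
  have hfin : ((P.roots.toFinset : Set ℂ) \ {0}).Finite :=
    (Finset.finite_toSet _).subset Set.sdiff_subset
  have hmem : ((P.roots.toFinset : Set ℂ) \ {0})ᶜ ∈ nhds (0 : ℂ) :=
    hfin.isClosed.isOpen_compl.mem_nhds (by simp)
  filter_upwards [nhdsWithin_le_nhds hmem, self_mem_nhdsWithin] with s hs hs0 h
  exact hs ⟨by simpa [hP] using h, hs0⟩

/-- Both quantities are polynomials in `s`, so it suffices that neither is identically zero. With `y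
1 = 1` the coefficient at `pureIndex d` is `F(e₁ + s x)`, equal to `F(u) ≠ 0` at `s = 1` for `x = u
- e₁`. The other is `Z₀ + s ((y·x) Z₀ - (y·Z) x₀)`, nonzero as a polynomial when `y·Z` and `x₀` are
nonzero. -/
theorem exists_transvectPath {p : HomogData d} (hp : p ∈ jetCone d) :
    ∃ x y : Fin 5 → ℂ, ∀ᶠ s in nhdsWithin (0 : ℂ) {0}ᶜ,
      (transvectPath x y p s).1 0 0 ≠ 0 ∧ (transvectPath x y p s).2 (pureIndex d) ≠ 0 := by
  have hF0 : formOf d p.2 ≠ 0 := fun h => hp.2.1 (by rw [← coeffsOf_formOf p.2, h, map_zero])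
  -- The extra factor `X 0` gives `u 0 ≠ 0`, hence `x 0 ≠ 0`; below, `X 1` likewise gives `w 1 ≠ 0`,
  -- so that `w` can be normalized to `y 1 = 1`.
  obtain ⟨u, hu⟩ := exists_eval_ne_zero (mul_ne_zero hF0 (MvPolynomial.X_ne_zero (0 : Fin 5)))
  have hlin : (∑ l, p.1 0 l • MvPolynomial.X l : MvPolynomial (Fin 5) ℂ) ≠ 0 := by
    intro h
    refine hp.1 (funext fun j => ?_)
    have := congrArg (MvPolynomial.eval (Pi.single j 1)) h
    simpa [Pi.single_apply] using this
  obtain ⟨w, hw⟩ := exists_eval_ne_zero (mul_ne_zero hlin (MvPolynomial.X_ne_zero (1 : Fin 5)))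
  simp only [map_mul, map_sum, MvPolynomial.smul_eval, MvPolynomial.eval_X, mul_ne_zero_iff]
    at hu hw
  set x : Fin 5 → ℂ := u - Pi.single 1 1 with hx
  set y : Fin 5 → ℂ := (w 1)⁻¹ • w with hy
  have hy1 : y 1 = 1 := by simp [hy, hw.2]
  have hx0 : x 0 ≠ 0 := by simpa [hx] using hu.2
  have hyZ : dotProduct y (p.1 0) ≠ 0 := by
    rw [hy, smul_dotProduct, smul_eq_mul, dotProduct_comm]
    exact mul_ne_zero (inv_ne_zero hw.2) hw.1
  set P : Polynomial ℂ := MvPolynomial.aeval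
    (fun j => Polynomial.C ((Pi.single 1 1 : Fin 5 → ℂ) j) + Polynomial.X * Polynomial.C (x j))
    (formOf d p.2) with hP
  have hPe : ∀ s, P.eval s = MvPolynomial.eval (fun j => (Pi.single 1 1 : Fin 5 → ℂ) j + s * x j)
      (formOf d p.2) := by
    intro s
    have h := MvPolynomial.comp_aeval_apply
      (fun j => Polynomial.C ((Pi.single 1 1 : Fin 5 → ℂ) j) + Polynomial.X * Polynomial.C (x j))
      (Polynomial.aeval s) (formOf d p.2)
    rw [← hP] at h
    simp [MvPolynomial.aeval_eq_eval, Polynomial.coe_aeval_eq_eval] at h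
    simpa only [mul_comm s] using h
  have hP0 : P ≠ 0 := by
    intro h
    have h1 := hPe 1
    rw [h, Polynomial.eval_zero] at h1
    refine hu.1 (Eq.trans ?_ h1.symm)
    congr 2
    funext j
    simp [hx]
  set Q : Polynomial ℂ := Polynomial.C (p.1 0 0) + Polynomial.C
    (dotProduct y x * p.1 0 0 - dotProduct y (p.1 0) * x 0) * Polynomial.X with hQ
  have hQ0 : Q ≠ 0 := by
    intro h
    have h0 := congrArg (Polynomial.coeff · 0) h
    have h1 := congrArg (Polynomial.coeff · 1) h
    simp [hQ] at h0 h1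
    rw [h0] at h1
    simp [hyZ, hx0] at h1
  refine ⟨x, y, ?_⟩
  filter_upwards [eventually_eval_ne_zero hP0, eventually_eval_ne_zero hQ0] with s hs1 hs2
  constructor
  · convert hs2 using 1
    simp [transvectPath, hQ]
    ring
  · convert hs1 using 1
    change coeffsOf d _ _ = _
    rw [coeffsOf_pureIndex (isHomogeneous_transvect x y s (isHomogeneous_formOf _)), hPe,
      ← MvPolynomial.aeval_eq_eval, ← MvPolynomial.aeval_eq_eval]
    rw [aeval_transvect]
    have h1 : ∑ l, y l * (Pi.single 1 1 : Fin 5 → ℂ) l = 1 := by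
      simp [Pi.single_apply, hy1]
    simp only [smul_eq_mul, h1, mul_one]

theorem mem_sigma_of_not_linearIndependent (p : jetCone d) (hp : ¬ LinearIndependent ℂ p.1.1) :
    Quotient.mk (jetSetoid d) p ∈ sigma d := by
  rw [sigma, mem_closure_iff]
  intro U hU hpU
  -- In the quotient topology a neighbourhood of the jet comes from an open set of homogeneous data,
  -- which contains the path for small `s`.
  obtain ⟨O, hO, hOU⟩ := isOpen_induced_iff.1 (hU.preimage continuous_quotient_mk')
  obtain ⟨x, y, hxy⟩ := exists_transvectPath p.2
  have hOp : transvectPath x y p.1 0 ∈ O := by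
    rw [transvectPath_zero]
    exact (Set.ext_iff.1 hOU p).2 hpU
  have hev : ∀ᶠ s in nhdsWithin (0 : ℂ) {0}ᶜ, transvectPath x y p.1 s ∈ O :=
    nhdsWithin_le_nhds ((continuous_transvectPath x y p.1).continuousAt.preimage_mem_nhds
      (hO.mem_nhds hOp))
  obtain ⟨s, hsO, h1, h2⟩ := (hev.and hxy).exists
  have hs : transvectPath x y p.1 s ∈ jetCone d := by
    refine ⟨fun h => h1 ?_, fun h => h2 ?_, jetEquation_transvectPath x y p.2.2.2 s⟩
    · rw [h]; rfl
    · rw [h]; rfl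
  refine ⟨Quotient.mk (jetSetoid d) ⟨_, hs⟩, (Set.ext_iff.1 hOU ⟨_, hs⟩).1 hsO, ?_⟩
  exact mem_sigmaZero h1 h2 (not_linearIndependent_transvectPath x y hp s)

end VerticalJets

end

theorem propositionp1 (d : ℕ) (hd : 1 ≤ d) :
    ∃ m : ℤ, ∀ x : VerticalJets.VerticalJet d, x ∉ VerticalJets.sigma d →
      VerticalJets.IsGloballyGeneratedAt d 12 m x := by
  -- The fields have the same degree in `a` as `a` itself, so no twist on `ℙ^{N_d}` is needed.
  refine ⟨0, fun x hx i β p hp hpx v hv => ?_⟩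
  have hli : LinearIndependent ℂ p.1.1 := by
    by_contra h
    exact hx (hpx ▸ VerticalJets.mem_sigma_of_not_linearIndependent p h)
  have hF := (VerticalJets.jetEquations_iff p.1).1 p.2.2.2
  exact VerticalJets.exists_twistedVectorField hp hv
    (VerticalJets.mem_fieldValues hd hp.2.1 hp.2.2.2 hF hli
      (VerticalJets.mem_tangentSpaceAt_iff.1 hv).2.2)
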